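/- Let $d\ge 1$, $0<\mu_-\le\mu_+<\infty$, and let $\mu\in L_\infty(\mathbb R^d\times\mathbb R^d)$ be a real function with $\mu_-\le\mu(x,y)\le\mu_+$, $\mu(x,y)=\mu(y,x)$, and $\mu(x+m,y+n)=\mu(x,y)$ for all $m,n\in\mathbb Z^d$ (almost everywhere in $(x,y)$). Let $0<\alpha<2$ and $\Omega=[0,1)^d$. Let $\widetilde H^{\alpha/2}(\Omega)$ be the space of functions in $H^{\alpha/2}(\Omega)$ whose $\mathbb Z^d$-periodic extension belongs to $H^{\alpha/2}_{\mathrm{loc}}(\mathbb R^d)$; identify such functions with their periodic extensions. For $\xi\in[-\pi,\pi)^d$ let $\mathbb A(\xi)=\mathbb A(\xi;\alpha,\mu)$ be the self-adjoint operator in $L_2(\Omega)$ that corresponds to the closed non-negative form $$a(\xi)[u,u]=\frac12\int_{\mathbb R^d}dy\int_\Omega dx\,\mu(x,y)\,\frac{|e^{i\langle\xi,x\rangle}u(x)-e^{i\langle\xi,y\rangle}u(y)|^2}{|x-y|^{d+\alpha}},\qquad u\in\widetilde H^{\alpha/2}(\Omega).$$ Put $$c_0(d,\alpha)=\int_{\mathbb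 R^d}\frac{1-\cos z_1}{|z|^{d+\alpha}}\,dz,\qquad d_0=\mu_-c_0(d,\alpha)\pi^\alpha,\qquad \delta_0=\pi\Bigl(\frac{\mu_-}{3\mu_+}\Bigr)^{1/\alpha}.$$ Let $F(\xi)$ be the spectral projection of $\mathbb A(\xi)$ that corresponds to the interval $[0,d_0/3]$, and let $P=(\cdot,\mathbf 1_\Omega)\mathbf 1_\Omega$ be the orthogonal projection of $L_2(\Omega)$ onto the constants. (i) If $0<\alpha<1$, then $\|F(\xi)-P\|_{L_2(\Omega)\to L_2(\Omega)}\le C\,|\xi|^\alpha$ for all $|\xi|\le\delta_0$. (ii) If $1\le\alpha<2$, then $\|F(\xi)-P\|_{L_2(\Omega)\to L_2(\Omega)}\le C\,\Theta(\xi)$ for all $|\xi|\le\delta_0$, where $\Theta(\xi)=|\xi|$ for $1<\alpha<2$ and $\Theta(\xi)=|\xi|\,(1+|\ln|\xi||)$ for $\alpha=1$ (with $\Theta(0)=0$). In both cases the constant $C$ depends only on $d$, $\alpha$, $\mu_-$ and $\mu_+$. -/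

import Mathlib

noncomputable section

namespace LevyBloch

open MeasureTheory Set
open scoped ENNReal ComplexConjugate InnerProductSpace

/-- The space `ℝ^d` with its Euclidean norm. -/
abbrev Space (d : ℕ) : Type := EuclideanSpace ℝ (Fin d)

/-- The periodicity cell `Ω = [0,1)^d` of the lattice `ℤ^d`. -/
def cell (d : ℕ) : Set (Space d) := {x | ∀ i, x i ∈ Ico (0 : ℝ) 1}

/-- Lebesgue measure on the cell `Ω`. -/
def cellMeasure (d : ℕ) : Measure (Space d) := volume.restrict (cell d)

/-- The complex Hilbert space `L₂(Ω)`. -/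
abbrev L2Cell (d : ℕ) : Type := Lp ℂ 2 (cellMeasure d)

/-- A lattice vector `n ∈ ℤ^d`, regarded as an element of `ℝ^d`. -/
def latticeVec {d : ℕ} (n : Fin d → ℤ) : Space d := WithLp.toLp 2 fun i => (n i : ℝ)

/-- The representative in `Ω` of the class of `x` modulo `ℤ^d`. -/
def toCell {d : ℕ} (x : Space d) : Space d := WithLp.toLp 2 fun i => Int.fract (x i)

/-- The `ℤ^d`-periodic extension to `ℝ^d` of (the restriction to `Ω` of) a function. -/
def periodicExt {d : ℕ} (u : Space d → ℂ) (x : Space d) : ℂ := u (toCell x)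

/-! ### Elementary facts on the periodic extension -/

theorem measurable_toCell {d : ℕ} : Measurable (toCell (d := d)) := by
  unfold toCell
  fun_prop

theorem measurableSet_cell (d : ℕ) : MeasurableSet (cell d) := by
  have h : cell d = ⋂ i, (fun x : Space d => x i) ⁻¹' Ico (0 : ℝ) 1 := by
    ext x
    simp [cell]
  rw [h]
  exact MeasurableSet.iInter fun i => measurableSet_Ico.preimage (by fun_prop)

theorem cellMeasure_cell_ne_top (d : ℕ) : cellMeasure d (cell d) ≠ ∞ := by
  have hb : Bornology.IsBounded (cell d) := by
    refine (Metric.isBounded_closedBall (x := (0 : Space d)) (r := √d)).subset ?_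
    intro x hx
    rw [mem_closedBall_zero_iff, EuclideanSpace.norm_eq]
    refine Real.sqrt_le_sqrt ?_
    calc ∑ i, ‖x i‖ ^ 2 ≤ ∑ _i : Fin d, (1 : ℝ) := by
          refine Finset.sum_le_sum fun i _ => ?_
          have h := hx i
          rw [Real.norm_eq_abs, sq_abs]
          nlinarith [h.1, h.2]
      _ = (d : ℝ) := by simp
  rw [cellMeasure, Measure.restrict_apply (measurableSet_cell d), inter_self]
  exact hb.measure_lt_top.ne

theorem toCell_mem {d : ℕ} (x : Space d) : toCell x ∈ cell d := fun i =>
  ⟨Int.fract_nonneg (x i), Int.fract_lt_one (x i)⟩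

theorem toCell_eq {d : ℕ} (x : Space d) :
    toCell x = x + latticeVec fun i => -⌊x i⌋ := by
  ext i
  simp [toCell, latticeVec, Int.fract, sub_eq_add_neg]

/-- Functions that agree almost everywhere on `Ω` have periodic extensions that agree almost
everywhere on `ℝ^d`. -/
theorem periodicExt_congr {d : ℕ} {f g : Space d → ℂ} (h : f =ᵐ[cellMeasure d] g) :
    periodicExt f =ᵐ[volume] periodicExt g := by
  have h1 : ∀ᵐ x ∂(volume : Measure (Space d)), x ∈ cell d → f x = g x :=
    (ae_restrict_iff' (measurableSet_cell d)).1 h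
  have h2 : ∀ n : Fin d → ℤ, ∀ᵐ x ∂(volume : Measure (Space d)),
      x + latticeVec n ∈ cell d → f (x + latticeVec n) = g (x + latticeVec n) := fun n =>
    (measurePreserving_add_right volume (latticeVec n)).quasiMeasurePreserving.ae h1
  filter_upwards [ae_all_iff.2 h2] with x hx
  have hc := toCell_mem x
  unfold periodicExt
  rw [toCell_eq] at hc ⊢
  exact hx _ hc

theorem periodicExt_add {d : ℕ} (u v : L2Cell d) :
    periodicExt (u + v : L2Cell d) =ᵐ[volume] fun x => periodicExt u x + periodicExt v x :=
  periodicExt_congr (Lp.coeFn_add u v)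

theorem periodicExt_smul {d : ℕ} (c : ℂ) (u : L2Cell d) :
    periodicExt (c • u : L2Cell d) =ᵐ[volume] fun x => c * periodicExt u x :=
  periodicExt_congr (Lp.coeFn_smul c u)

theorem periodicExt_zero {d : ℕ} :
    periodicExt (0 : L2Cell d) =ᵐ[volume] fun _ => 0 :=
  periodicExt_congr (Lp.coeFn_zero ℂ 2 (cellMeasure d))

theorem measurable_periodicExt {d : ℕ} (u : L2Cell d) : Measurable (periodicExt u) :=
  (Lp.stronglyMeasurable u).measurable.comp measurable_toCell

/-! ### Sobolev spaces of fractional order -/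

/-- The Gagliardo (Sobolev-Slobodeckii) energy
`∫_U ∫_U |f(x) - f(y)|² / |x - y|^{d+2s} dx dy`. -/
def gagliardo {d : ℕ} (s : ℝ) (U : Set (Space d)) (f : Space d → ℂ) : ℝ≥0∞ :=
  ∫⁻ p in U ×ˢ U, ENNReal.ofReal (‖f p.1 - f p.2‖ ^ 2 / ‖p.1 - p.2‖ ^ ((d : ℝ) + 2 * s))

/-- Membership in `H^s(U)`, for `0 < s < 1`. -/
def MemHs {d : ℕ} (s : ℝ) (U : Set (Space d)) (f : Space d → ℂ) : Prop :=
  MemLp f 2 (volume.restrict U) ∧ gagliardo s U f < ∞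

/-- Membership in `H^s_loc(ℝ^d)`, for `0 < s < 1`. -/
def MemHsLoc {d : ℕ} (s : ℝ) (f : Space d → ℂ) : Prop :=
  ∀ R : ℝ, MemHs s (Metric.ball 0 R) f

theorem ae_prod_of_ae {d : ℕ} {m : Measure (Space d)} [SFinite m] (hm : m ≪ volume)
    {Q : Space d → Prop} (h : ∀ᵐ x, Q x) :
    ∀ᵐ p ∂(m.prod (volume : Measure (Space d))), Q p.1 ∧ Q p.2 :=
  (Measure.quasiMeasurePreserving_fst.ae (hm.ae_le h)).and
    (Measure.quasiMeasurePreserving_snd.ae h)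

theorem MemHsLoc.congr {d : ℕ} {s : ℝ} {f g : Space d → ℂ} (hf : MemHsLoc s f)
    (h : f =ᵐ[volume] g) : MemHsLoc s g := by
  intro R
  refine ⟨(hf R).1.ae_eq (ae_restrict_of_ae h), ?_⟩
  have h2 : gagliardo s (Metric.ball 0 R) g = gagliardo s (Metric.ball 0 R) f := by
    unfold gagliardo
    refine lintegral_congr_ae (ae_restrict_of_ae ?_)
    filter_upwards [ae_prod_of_ae Measure.AbsolutelyContinuous.rfl h] with p hp
    rw [hp.1, hp.2]
  rw [h2]
  exact (hf R).2

theorem MemHsLoc.zero {d : ℕ} {s : ℝ} : MemHsLoc s (fun _ : Space d => (0 : ℂ)) := fun R =>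
  ⟨MemLp.zero' , by simp [gagliardo]⟩

theorem MemHsLoc.const_mul {d : ℕ} {s : ℝ} {f : Space d → ℂ} (hf : MemHsLoc s f) (c : ℂ) :
    MemHsLoc s (fun x => c * f x) := by
  intro R
  refine ⟨(hf R).1.const_mul c, ?_⟩
  have h : gagliardo s (Metric.ball 0 R) (fun x => c * f x) =
      ENNReal.ofReal (‖c‖ ^ 2) * gagliardo s (Metric.ball 0 R) f := by
    unfold gagliardo
    rw [← lintegral_const_mul' _ _ ENNReal.ofReal_ne_top]
    refine lintegral_congr fun p => ?_
    rw [← ENNReal.ofReal_mul (by positivity), ← mul_sub, norm_mul, mul_pow, mul_div_assoc]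
  rw [h]
  exact ENNReal.mul_lt_top ENNReal.ofReal_lt_top (hf R).2

theorem MemHsLoc.add {d : ℕ} {s : ℝ} {f g : Space d → ℂ} (hf : MemHsLoc s f)
    (hg : MemHsLoc s g) (hfm : Measurable f) : MemHsLoc s (fun x => f x + g x) := by
  intro R
  refine ⟨(hf R).1.add (hg R).1, ?_⟩
  have hle : gagliardo s (Metric.ball 0 R) (fun x => f x + g x) ≤
      ENNReal.ofReal 2 * gagliardo s (Metric.ball 0 R) f +
        ENNReal.ofReal 2 * gagliardo s (Metric.ball 0 R) g := by
    unfold gagliardo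
    rw [← lintegral_const_mul' _ _ (by simp), ← lintegral_const_mul' _ _ (by simp),
      ← lintegral_add_left (by fun_prop)]
    refine lintegral_mono fun p => ?_
    rw [← ENNReal.ofReal_mul (by norm_num), ← ENNReal.ofReal_mul (by norm_num),
      ← ENNReal.ofReal_add (by positivity) (by positivity),
      ← mul_div_assoc, ← mul_div_assoc, ← add_div]
    refine ENNReal.ofReal_le_ofReal ?_
    gcongr
    have h1 : ‖f p.1 + g p.1 - (f p.2 + g p.2)‖ ≤ ‖f p.1 - f p.2‖ + ‖g p.1 - g p.2‖ := by
      rw [add_sub_add_comm]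
      exact norm_add_le _ _
    nlinarith [norm_nonneg (f p.1 + g p.1 - (f p.2 + g p.2)),
      sq_nonneg (‖f p.1 - f p.2‖ - ‖g p.1 - g p.2‖)]
  refine hle.trans_lt (ENNReal.add_lt_top.2 ⟨?_, ?_⟩)
  · exact ENNReal.mul_lt_top (by simp) (hf R).2
  · exact ENNReal.mul_lt_top (by simp) (hg R).2

/-- The space `H̃^s(Ω)`, for `0 < s < 1`: the functions `u` on `Ω` whose `ℤ^d`-periodic extension
belongs to `H^s_loc(ℝ^d)` (so that `u ∈ H^s(Ω)`, because `Ω` is bounded). -/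
def periodicSobolev (d : ℕ) (s : ℝ) : Submodule ℂ (L2Cell d) where
  carrier := {u | MemHsLoc s (periodicExt u)}
  zero_mem' := MemHsLoc.zero.congr periodicExt_zero.symm
  add_mem' {u v} hu hv :=
    (MemHsLoc.add hu hv (measurable_periodicExt u)).congr (periodicExt_add u v).symm
  smul_mem' c u hu := (MemHsLoc.const_mul hu c).congr (periodicExt_smul c u).symm

/-! ### The forms `a(ξ; α, μ)` and the operators `A(ξ; α, μ)` -/

/-- The assumptions on the coefficient `μ ∈ L_∞(ℝ^d × ℝ^d)`: the bounds `μ₋ ≤ μ ≤ μ₊`, symmetry,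
and `ℤ^d`-periodicity in each of the two variables. -/
structure IsCoefficient {d : ℕ} (μminus μplus : ℝ) (μ : Space d → Space d → ℝ) : Prop where
  aestronglyMeasurable :
    AEStronglyMeasurable (fun p : Space d × Space d => μ p.1 p.2) volume
  bounds : ∀ᵐ p : Space d × Space d, μminus ≤ μ p.1 p.2 ∧ μ p.1 p.2 ≤ μplus
  symm : ∀ᵐ p : Space d × Space d, μ p.1 p.2 = μ p.2 p.1
  periodic : ∀ m n : Fin d → ℤ, ∀ᵐ p : Space d × Space d,
    μ (p.1 + latticeVec m) (p.2 + latticeVec n) = μ p.1 p.2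

/-- The quasi-periodic function `e^{i⟨ξ,x⟩} u(x)` on `ℝ^d`, where `u` is identified with its
periodic extension. -/
def bloch {d : ℕ} (ξ : Space d) (u : L2Cell d) (x : Space d) : ℂ :=
  Complex.exp (Complex.I * (⟪ξ, x⟫_ℝ : ℝ)) * periodicExt u x

/-- The integrand of the sesquilinear form `a(ξ; α, μ)[u, v]` at the point `p = (x, y)`. -/
def formIntegrand {d : ℕ} (α : ℝ) (μ : Space d → Space d → ℝ) (ξ : Space d) (u v : L2Cell d)
    (p : Space d × Space d) : ℂ :=
  ((μ p.1 p.2 / ‖p.1 - p.2‖ ^ ((d : ℝ) + α) : ℝ) : ℂ) *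
    ((bloch ξ u p.1 - bloch ξ u p.2) * conj (bloch ξ v p.1 - bloch ξ v p.2))

/-- The measure `dx dy` on `Ω × ℝ^d`. -/
def stripMeasure (d : ℕ) : Measure (Space d × Space d) := (cellMeasure d).prod volume

/-- The sesquilinear form (linear in `u`, conjugate-linear in `v`)
`a(ξ; α, μ)[u, v] = ½ ∫_{ℝ^d} dy ∫_Ω dx μ(x,y)
  (e^{i⟨ξ,x⟩}u(x) - e^{i⟨ξ,y⟩}u(y)) (e^{i⟨ξ,x⟩}v(x) - e^{i⟨ξ,y⟩}v(y))^* / |x-y|^{d+α}`. -/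
def form {d : ℕ} (α : ℝ) (μ : Space d → Space d → ℝ) (ξ : Space d) (u v : L2Cell d) : ℂ :=
  (1 / 2 : ℂ) * ∫ p, formIntegrand α μ ξ u v p ∂(stripMeasure d)

theorem ae_strip {d : ℕ} {Q : Space d → Prop} (h : ∀ᵐ x, Q x) :
    ∀ᵐ p ∂(stripMeasure d), Q p.1 ∧ Q p.2 := by
  unfold stripMeasure cellMeasure
  exact ae_prod_of_ae Measure.restrict_le_self.absolutelyContinuous h

theorem formIntegrand_add {d : ℕ} (α : ℝ) (μ : Space d → Space d → ℝ) (ξ : Space d)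
    (u u' v : L2Cell d) :
    formIntegrand α μ ξ (u + u') v =ᵐ[stripMeasure d]
      formIntegrand α μ ξ u v + formIntegrand α μ ξ u' v := by
  filter_upwards [ae_strip (periodicExt_add u u')] with p hp
  simp only [formIntegrand, bloch, Pi.add_apply, hp.1, hp.2]
  ring

theorem formIntegrand_smul {d : ℕ} (α : ℝ) (μ : Space d → Space d → ℝ) (ξ : Space d) (c : ℂ)
    (u v : L2Cell d) :
    formIntegrand α μ ξ (c • u) v =ᵐ[stripMeasure d]
      fun p => c * formIntegrand α μ ξ u v p := by
  filter_upwards [ae_strip (periodicExt_smul c u)] with p hp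
  simp only [formIntegrand, bloch, hp.1, hp.2]
  ring

theorem formIntegrand_zero {d : ℕ} (α : ℝ) (μ : Space d → Space d → ℝ) (ξ : Space d)
    (v : L2Cell d) :
    formIntegrand α μ ξ 0 v =ᵐ[stripMeasure d] fun _ => (0 : ℂ) := by
  filter_upwards [ae_strip periodicExt_zero] with p hp
  simp only [formIntegrand, bloch, hp.1, hp.2]
  ring

/-- The graph of the operator associated with the form `a(ξ; α, μ)` with domain `H̃^{α/2}(Ω)`:
the pairs `(u, w)` with `u ∈ H̃^{α/2}(Ω)`, `w ∈ L₂(Ω)` and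
`a(ξ; α, μ)[u, v] = (w, v)_{L₂(Ω)}` for all `v ∈ H̃^{α/2}(Ω)`. The integral that defines
`a(ξ; α, μ)[u, v]` is required to converge absolutely. -/
def operatorGraph {d : ℕ} (α : ℝ) (μ : Space d → Space d → ℝ) (ξ : Space d) :
    Submodule ℂ (L2Cell d × L2Cell d) where
  carrier := {q | q.1 ∈ periodicSobolev d (α / 2) ∧ ∀ v ∈ periodicSobolev d (α / 2),
    Integrable (formIntegrand α μ ξ q.1 v) (stripMeasure d) ∧ form α μ ξ q.1 v = ⟪v, q.2⟫_ℂ}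
  zero_mem' := by
    refine ⟨Submodule.zero_mem _, fun v _ => ⟨?_, ?_⟩⟩
    · exact (integrable_zero _ _ _).congr (formIntegrand_zero α μ ξ v).symm
    · simp only [form, Prod.fst_zero, Prod.snd_zero, inner_zero_right]
      rw [integral_congr_ae (formIntegrand_zero α μ ξ v)]
      simp
  add_mem' := by
    rintro ⟨u, w⟩ ⟨u', w'⟩ ⟨hu, h⟩ ⟨hu', h'⟩
    refine ⟨Submodule.add_mem _ hu hu', fun v hv => ⟨?_, ?_⟩⟩
    · exact ((h v hv).1.add (h' v hv).1).congr (formIntegrand_add α μ ξ u u' v).symm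
    · have e := (h v hv).2
      have e' := (h' v hv).2
      simp only [form] at e e' ⊢
      rw [Prod.mk_add_mk, inner_add_right, ← e, ← e',
        integral_congr_ae (formIntegrand_add α μ ξ u u' v),
        integral_add' (h v hv).1 (h' v hv).1, mul_add]
  smul_mem' := by
    rintro c ⟨u, w⟩ ⟨hu, h⟩
    refine ⟨Submodule.smul_mem _ c hu, fun v hv => ⟨?_, ?_⟩⟩
    · exact ((h v hv).1.const_mul c).congr (formIntegrand_smul α μ ξ c u v).symm
    · have e := (h v hv).2
      simp only [form] at e ⊢
      rw [Prod.smul_mk, inner_smul_right, ← e,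
        integral_congr_ae (formIntegrand_smul α μ ξ c u v), integral_const_mul]
      ring

/-- The operator `A(ξ; α, μ)` in `L₂(Ω)` that corresponds to the form `a(ξ; α, μ)`. -/
def levyOperator {d : ℕ} (α : ℝ) (μ : Space d → Space d → ℝ) (ξ : Space d) :
    L2Cell d →ₗ.[ℂ] L2Cell d :=
  (operatorGraph α μ ξ).toLinearPMap

/-! ### Spectral projections of an unbounded self-adjoint operator -/

/-- `E` is the projection-valued spectral measure of the (unbounded, self-adjoint) operator `A`:
`E` is a multiplicative family of orthogonal projections, indexed by the Borel sets of `ℝ`, with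
`E(ℝ) = I`; for every `x`, `s ↦ ‖E(s)x‖² = (E(s)x, x)` is a measure `m_x`; and `A = ∫ t dE(t)`,
that is, `Dom A = {x : ∫ t² dm_x < ∞}` and `(A x, x) = ∫ t dm_x` for `x ∈ Dom A`. -/
structure IsSpectralMeasure {H : Type*} [NormedAddCommGroup H] [InnerProductSpace ℂ H]
    [CompleteSpace H] (A : H →ₗ.[ℂ] H) (E : Set ℝ → H →L[ℂ] H) : Prop where
  isStarProjection : ∀ s, MeasurableSet s → IsStarProjection (E s)
  univ : E Set.univ = 1
  inter : ∀ s t, MeasurableSet s → MeasurableSet t → E (s ∩ t) = E s * E t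
  integral : ∀ x : H, ∃ m : Measure ℝ,
    (∀ s, MeasurableSet s → m s = ENNReal.ofReal (‖E s x‖ ^ 2)) ∧
    (x ∈ A.domain ↔ ∫⁻ t, ENNReal.ofReal (t ^ 2) ∂m < ∞) ∧
    ∀ hx : x ∈ A.domain, ⟪x, A ⟨x, hx⟩⟫_ℂ = ((∫ t, t ∂m : ℝ) : ℂ)

/-- `F` is the spectral projection of `A` that corresponds to the Borel set `s`. -/
def IsSpectralProjection {H : Type*} [NormedAddCommGroup H] [InnerProductSpace ℂ H]
    [CompleteSpace H] (A : H →ₗ.[ℂ] H) (s : Set ℝ) (F : H →L[ℂ] H) : Prop :=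
  ∃ E, IsSpectralMeasure A E ∧ F = E s

/-! ### Threshold quantities -/

/-- The function `1_Ω` as an element of `L₂(Ω)`. -/
def oneCell (d : ℕ) : L2Cell d :=
  indicatorConstLp 2 (measurableSet_cell d) (cellMeasure_cell_ne_top d) 1

/-- The orthogonal projection `P` of `L₂(Ω)` onto the constants. -/
def projConst (d : ℕ) : L2Cell d →L[ℂ] L2Cell d :=
  (Submodule.span ℂ {oneCell d}).starProjection

/-- The constant `c₀(d,α) = ∫_{ℝ^d} (1 - cos z₁) / |z|^{d+α} dz`. -/
def c0 (d : ℕ) [NeZero d] (α : ℝ) : ℝ :=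
  ∫ z : Space d, (1 - Real.cos (z 0)) / ‖z‖ ^ ((d : ℝ) + α)

/-- The constant `d₀ = μ₋ c₀(d,α) π^α`. -/
def d0 (d : ℕ) [NeZero d] (α μminus : ℝ) : ℝ := μminus * c0 d α * Real.pi ^ α

/-- The radius `δ₀(α,μ) = π (μ₋ / (3 μ₊))^{1/α}`. -/
def delta0 (α μminus μplus : ℝ) : ℝ := Real.pi * (μminus / (3 * μplus)) ^ (1 / α)

open scoped Classical in
/-- `Θ(ξ) = |ξ| (1 + |ln |ξ||)` for `α = 1`, and `Θ(ξ) = |ξ|` otherwise. At `ξ = 0` its value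
is `0`. -/
def Theta {d : ℕ} (α : ℝ) (ξ : Space d) : ℝ :=
  if α = 1 then ‖ξ‖ * (1 + |Real.log ‖ξ‖|) else ‖ξ‖

end LevyBloch

end

/-! The form is `a(ξ)[u, v] = (D u, D v)` for a closed, densely defined operator `D = diffOp` into
`L₂(Ω × ℝ^d)`. For constant `μ` it is diagonalised by the characters `e^{2πi⟨n,x⟩}`: translating in
`x` and applying Parseval gives the symbol `c₀|ξ + 2πn|^α` (`energy_eq_tsum`). For general `μ` the
bounds `μ₋ ≤ μ ≤ μ₊` make the form comparable to this one. Hence the domain is `H̃^{α/2}(Ω)` for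
every `ξ`, the embedding into `L₂(Ω)` is compact, and `𝔸(ξ)` is diagonal in an orthonormal basis
(`exists_eigenbasis`). The projections onto spans of eigenvectors form a spectral measure
(`isSpectralMeasure_diagProj`), which provides `F`.

Spectral gap: if `u ⊥ 1` and `|ξ| ≤ π`, only frequencies with `|ξ + 2πn| ≥ π` occur, so `a(ξ)[u, u]
≥ d₀‖u‖²`. On the range of `F` the form is at most `(d₀/3)‖u‖²`. The range therefore meets `1^⊥`
only in `0`, and `‖F - P‖ ≤ 4‖w‖` with `w = 1 - F1` (`norm_sub_starProjection_le`). The radius `δ₀`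
enters only through `δ₀ ≤ π`: the rank of `F` need not be known to equal one, since `‖w‖ ≥ 1/2`
already makes the bound trivial.

It remains to estimate `w`. Since `w` and `F1` are orthogonal for the form, `(d₀/3)‖w‖² ≤ a(ξ)[w, w]
= a(ξ)[1, w]` (`form_diagProj_compl`). Cauchy–Schwarz on the whole form would give only `‖w‖ =
O(|ξ|^{α/2})`, because `a(ξ)[1, 1]` is of order `|ξ|^α`. The form is split instead. Where `|x - y| ≤
1`, the energy of `1` is `O(|ξ|²)`, and half of `a(ξ)[w, w]` is absorbed. Where `|x - y| > 1`, the
kernel is integrable and the increment of `w` is replaced by `|w(x)| + |w(y)|`; this leaves `‖w‖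
∫_{|z|>1} min(2, |ξ||z|)|z|^{-d-α} dz`, linear in `‖w‖`. The last integral is `O(|ξ|^α)`, `O(|ξ|(1 +
|ln|ξ||))` or `O(|ξ|)` according as `α < 1`, `α = 1` or `α > 1` (`exists_lintegral_tail_le`).
Young's inequality gives `‖w‖ ≤ C(|ξ| + rate)`. -/

noncomputable section

namespace LevyBloch

open MeasureTheory Set Filter Topology
open scoped ENNReal ComplexConjugate InnerProductSpace

section

/-! ### Operators with compact resolvent that are generated by closed forms -/

section Abstract

universe u

variable {H : Type u} {K : Type*} [NormedAddCommGroup H] [InnerProductSpace ℂ H] [CompleteSpace H]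
  [NormedAddCommGroup K] [InnerProductSpace ℂ K] [CompleteSpace K]

/-- For a closed operator `D` from `H` to `K` with domain `V`, the operator `(1 + D⋆D)⁻¹`. -/
theorem exists_resolvent {V : Submodule ℂ H} (D : V →ₗ[ℂ] K)
    (hD : ∀ (x : ℕ → V) (u : H) (g : K), Tendsto (fun n => (x n : H)) atTop (𝓝 u) →
      Tendsto (fun n => D (x n)) atTop (𝓝 g) → ∃ h : u ∈ V, D ⟨u, h⟩ = g) :
    ∃ R : H →L[ℂ] H, ∀ f : H, ∃ h : R f ∈ V, ∀ v : V,
      ⟪(v : H), R f⟫_ℂ + ⟪D v, D ⟨R f, h⟩⟫_ℂ = ⟪(v : H), f⟫_ℂ := by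
  -- The range `Γ` of `φ` is the graph of `D`; closedness of `D` makes it a Hilbert space, namely
  -- `V` with the graph inner product.
  let φ : V →ₗ[ℂ] WithLp 2 (H × K) :=
    (WithLp.linearEquiv 2 ℂ (H × K)).symm.toLinearMap ∘ₗ (V.subtype.prod D)
  have hφ : ∀ v : V, φ v = WithLp.toLp 2 ((v : H), D v) := fun v => rfl
  let Γ : Submodule ℂ (WithLp 2 (H × K)) := LinearMap.range φ
  have hΓ : IsClosed (Γ : Set (WithLp 2 (H × K))) := by
    refine IsSeqClosed.isClosed ?_
    intro z p hz hp
    choose x hx using hz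
    have h1 : Tendsto (fun n => (z n).ofLp.1) atTop (𝓝 p.ofLp.1) :=
      ((WithLp.fstL 2 ℂ H K).continuous.tendsto p).comp hp
    have h2 : Tendsto (fun n => (z n).ofLp.2) atTop (𝓝 p.ofLp.2) :=
      ((WithLp.sndL 2 ℂ H K).continuous.tendsto p).comp hp
    simp only [← hx, hφ] at h1 h2
    obtain ⟨h, e⟩ := hD x _ _ h1 h2
    exact ⟨⟨_, h⟩, by rw [hφ, e]⟩
  have : CompleteSpace Γ := hΓ.completeSpace_coe
  let J : Γ →L[ℂ] H := (WithLp.fstL 2 ℂ H K) ∘L Γ.subtypeL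
  -- With `J` the first projection of the graph, the relation `(φ v, J⋆f) = (J φ v, f)` is the weak
  -- form of `(1 + D⋆D) R f = f` for `R = J J⋆`.
  refine ⟨J ∘L J.adjoint, fun f => ?_⟩
  obtain ⟨u, hu⟩ := (J.adjoint f).2
  have hR : (J ∘L J.adjoint) f = u := by
    change ((J.adjoint f : Γ) : WithLp 2 (H × K)).ofLp.1 = u
    rw [← hu]
    rfl
  have hV : (J ∘L J.adjoint) f ∈ V := hR ▸ u.2
  refine ⟨hV, fun v => ?_⟩
  have e : (⟨(J ∘L J.adjoint) f, hV⟩ : V) = u := Subtype.ext hR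
  rw [e, hR]
  have h1 : ⟪J ⟨φ v, v, rfl⟩, f⟫_ℂ = ⟪(v : H), f⟫_ℂ := rfl
  rw [← h1, ← ContinuousLinearMap.adjoint_inner_right, Submodule.coe_inner, ← hu]
  rfl

/-- An operator that is generated by a closed form with compactly embedded domain is diagonal in
an orthonormal basis. -/
theorem exists_eigenbasis {V : Submodule ℂ H} (D : V →ₗ[ℂ] K)
    (hV : Dense (V : Set H))
    (hD : ∀ (x : ℕ → V) (u : H) (g : K), Tendsto (fun n => (x n : H)) atTop (𝓝 u) →
      Tendsto (fun n => D (x n)) atTop (𝓝 g) → ∃ h : u ∈ V, D ⟨u, h⟩ = g)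
    (hP : ∀ ε : ℝ, 0 < ε → ∃ P : H →L[ℂ] H, IsCompactOperator P ∧
      ∀ v : V, ‖(v : H) - P v‖ ≤ ε * ‖D v‖) :
    ∃ (ι : Type u) (b : HilbertBasis ι ℂ H) (lam : ι → ℝ), (∀ i, 0 ≤ lam i) ∧
      ∀ u w : H, (∃ h : u ∈ V, ∀ v : V, ⟪D v, D ⟨u, h⟩⟫_ℂ = ⟪(v : H), w⟫_ℂ) ↔
        ∀ i, ⟪b i, w⟫_ℂ = lam i * ⟪b i, u⟫_ℂ := by
  obtain ⟨R, hR⟩ := exists_resolvent D hD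
  choose hRV hR using hR
  have hzero : ∀ x : H, (∀ v : V, ⟪(v : H), x⟫_ℂ = 0) → x = 0 := fun x hx =>
    hV.eq_zero_of_inner_left (𝕜 := ℂ) fun v hv => by
      rw [← inner_conj_symm, hx ⟨v, hv⟩, map_zero]
  have hinj : ∀ f, R f = 0 → f = 0 := by
    intro f hf
    refine hzero f fun v => ?_
    have e : (⟨R f, hRV f⟩ : V) = 0 := Subtype.ext hf
    rw [← hR f v, e, hf]
    simp
  have hsymm : (R : H →ₗ[ℂ] H).IsSymmetric := by
    intro f g
    change ⟪R f, g⟫_ℂ = ⟪f, R g⟫_ℂ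
    rw [← hR g ⟨R f, hRV f⟩, ← inner_conj_symm f, ← hR f ⟨R g, hRV g⟩]
    simp
  have hnorm : ∀ f, ‖R f‖ ^ 2 + ‖D ⟨R f, hRV f⟩‖ ^ 2 ≤ ‖R f‖ * ‖f‖ := by
    intro f
    have h := congrArg Complex.re (hR f ⟨R f, hRV f⟩)
    rw [Complex.add_re] at h
    have e1 := inner_self_eq_norm_sq (𝕜 := ℂ) (R f)
    have e2 := inner_self_eq_norm_sq (𝕜 := ℂ) (D ⟨R f, hRV f⟩)
    simp only [RCLike.re_to_complex] at e1 e2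
    rw [← e1, ← e2, h]
    exact re_inner_le_norm (𝕜 := ℂ) (R f) f
  have hnormR : ∀ f, ‖R f‖ ≤ ‖f‖ := by
    intro f
    by_contra! h
    nlinarith [hnorm f, norm_nonneg f, norm_nonneg (R f), sq_nonneg ‖D ⟨R f, hRV f⟩‖]
  have hnormD : ∀ f, ‖D ⟨R f, hRV f⟩‖ ≤ ‖f‖ := by
    intro f
    refine (sq_le_sq₀ (norm_nonneg _) (norm_nonneg f)).1 ?_
    nlinarith [hnorm f, norm_nonneg f, norm_nonneg (R f), hnormR f]
  -- `R` is the norm limit of the compact operators `Pₙ R`, because `‖R f - Pₙ R f‖ ≤ ‖D R f‖ / (n +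
  -- 1) ≤ ‖f‖ / (n + 1)`.
  have hcomp : IsCompactOperator R := by
    have hP' : ∀ n : ℕ, ∃ P : H →L[ℂ] H, IsCompactOperator P ∧
      ∀ v : V, ‖(v : H) - P v‖ ≤ (1 / ((n : ℝ) + 1)) * ‖D v‖ := fun n =>
        hP _ Nat.one_div_pos_of_nat
    choose P hPc hPb using hP'
    refine isCompactOperator_of_tendsto (l := atTop) (F := fun n => P n ∘L R) ?_
      (Eventually.of_forall fun n => (hPc n).comp_clm R)
    rw [tendsto_iff_norm_sub_tendsto_zero]
    refine squeeze_zero (fun _ => norm_nonneg _) (fun n => ?_)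
      tendsto_one_div_add_atTop_nhds_zero_nat
    refine ContinuousLinearMap.opNorm_le_bound _ (by positivity) fun f => ?_
    have h := hPb n ⟨R f, hRV f⟩
    rw [norm_sub_rev] at h
    refine h.trans ?_
    gcongr
    exact hnormD f
  have horth := hsymm.orthogonalFamily_eigenspaces
  have hbot := ContinuousLinearMap.orthogonalComplement_iSup_eigenspaces_eq_bot hcomp hsymm
  have hcl : ∀ κ : ℂ, CompleteSpace (Module.End.eigenspace (R : H →ₗ[ℂ] H) κ) := by
    intro κ
    have : IsClosed ((Module.End.eigenspace (R : H →ₗ[ℂ] H) κ : Submodule ℂ H) : Set H) := by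
      have e : ((Module.End.eigenspace (R : H →ₗ[ℂ] H) κ : Submodule ℂ H) : Set H)
          = {x | R x = κ • x} := by
        ext x
        simp
      rw [e]
      exact isClosed_eq R.continuous (continuous_const_smul κ)
    exact this.completeSpace_coe
  -- All `κ ∈ ℂ` are admitted: a `κ` that is not an eigenvalue has zero eigenspace and contributes
  -- no basis vectors.
  have hbas := fun κ : ℂ => exists_hilbertBasis ℂ (Module.End.eigenspace (R : H →ₗ[ℂ] H) κ)
  choose wb bb hbb using hbas
  have hon := horth.orthonormal_sigma_orthonormal (v_family := fun κ => bb κ)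
    (fun κ => (bb κ).orthonormal)
  have hspan : (Submodule.span ℂ (Set.range fun a : Σ κ : ℂ, wb κ =>
      (Module.End.eigenspace (R : H →ₗ[ℂ] H) a.1).subtypeₗᵢ (bb a.1 a.2)))ᗮ = ⊥ := by
    rw [Submodule.eq_bot_iff]
    intro x hx
    have hx' : x ∈ (⨆ κ, Module.End.eigenspace (R : H →ₗ[ℂ] H) κ)ᗮ := by
      rw [← Submodule.iInf_orthogonal, Submodule.mem_iInf]
      intro κ
      rw [Submodule.mem_orthogonal]
      intro y hy
      have h1 := ((bb κ).hasSum_repr ⟨y, hy⟩).mapL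
        ((innerSL ℂ x) ∘L (Module.End.eigenspace (R : H →ₗ[ℂ] H) κ).subtypeL)
      have h2 : ∀ i, ((innerSL ℂ x) ∘L (Module.End.eigenspace (R : H →ₗ[ℂ] H) κ).subtypeL)
          ((bb κ).repr ⟨y, hy⟩ i • bb κ i) = 0 := by
        intro i
        rw [map_smul]
        have : ⟪x, (bb κ i : H)⟫_ℂ = 0 :=
          Submodule.inner_left_of_mem_orthogonal
            (Submodule.subset_span (Set.mem_range_self (⟨κ, i⟩ : Σ κ : ℂ, wb κ))) hx
        change _ • ⟪x, (bb κ i : H)⟫_ℂ = 0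
        rw [this, smul_zero]
      simp only [h2] at h1
      have h3 : ⟪x, y⟫_ℂ = 0 := h1.unique hasSum_zero
      rw [← inner_conj_symm, h3, map_zero]
    rw [hbot] at hx'
    exact hx'
  let b := HilbertBasis.mkOfOrthogonalEqBot hon hspan
  have hRb : ∀ a, R (b a) = a.1 • b a := by
    intro a
    have e : b a = (bb a.1 a.2 : H) := by
      simp [b, HilbertBasis.coe_mkOfOrthogonalEqBot]
    rw [e]
    exact Module.End.mem_eigenspace_iff.1 (bb a.1 a.2).2
  have hb0 : ∀ a, b a ≠ 0 := fun a => b.orthonormal.ne_zero a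
  -- the eigenvalues are real, positive, and at most one
  have hκ : ∀ a : Σ κ : ℂ, wb κ, ∃ t : ℝ, 0 ≤ t ∧ a.1 * (1 + t) = 1 := by
    intro a
    have h := hR (b a) ⟨R (b a), hRV (b a)⟩
    have hself : ⟪b a, b a⟫_ℂ = 1 := by
      rw [inner_self_eq_norm_sq_to_K, b.orthonormal.1 a]; simp
    have hD2 := inner_self_eq_norm_sq_to_K (𝕜 := ℂ) (D ⟨R (b a), hRV (b a)⟩)
    obtain ⟨q, hq⟩ : ∃ q : ℝ, q = ‖D ⟨R (b a), hRV (b a)⟩‖ ^ 2 := ⟨_, rfl⟩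
    have hcast : (‖D ⟨R (b a), hRV (b a)⟩‖ : ℂ) ^ 2 = q := by rw [hq]; push_cast; rfl
    rw [hD2] at h
    change _ + (‖D ⟨R (b a), hRV (b a)⟩‖ : ℂ) ^ 2 = _ at h
    rw [hcast] at h
    simp only [hRb, inner_smul_left, inner_smul_right, hself] at h
    have hne : a.1 ≠ 0 := by
      intro h0
      refine hb0 a (hinj _ ?_)
      rw [hRb, h0, zero_smul]
    have hq0 : 0 ≤ q := hq ▸ sq_nonneg _
    -- The resolvent identity for `f = b a`, tested with `R (b a)`. It forces the eigenvalue `κ` to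
    -- be real with `κ² ≤ κ`; injectivity of `R` excludes `κ = 0`, and the eigenvalue of `D⋆D` is
    -- then `κ⁻¹ - 1 ≥ 0`.
    have h' : (Complex.normSq a.1 : ℂ) + (q : ℂ) = conj a.1 := by
      rw [Complex.normSq_eq_conj_mul_self]
      linear_combination h
    have him : a.1.im = 0 := by
      have := congrArg Complex.im h'
      simp at this
      linarith
    have hre : a.1 = (a.1.re : ℂ) := Complex.ext rfl (by simp [him])
    have hre' : a.1.re ^ 2 + q = a.1.re := by
      have := congrArg Complex.re h'
      simp [Complex.normSq_apply, him] at this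
      nlinarith
    have hne' : a.1.re ≠ 0 := by
      intro h0
      rw [h0] at hre
      exact hne (by simpa using hre)
    have hpos : 0 < a.1.re := lt_of_le_of_ne (by nlinarith [sq_nonneg a.1.re]) (Ne.symm hne')
    refine ⟨(a.1.re)⁻¹ - 1, ?_, ?_⟩
    · rw [sub_nonneg]
      refine (one_le_inv₀ hpos).2 ?_
      nlinarith
    · rw [hre]
      push_cast
      have : (a.1.re : ℂ) ≠ 0 := by exact_mod_cast hne'
      simp only [Complex.ofReal_re]
      field_simp
      ring
  choose lam hlam0 hlam using hκ
  refine ⟨_, b, lam, hlam0, fun u w => ?_⟩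
  have hinner : ∀ a f, ⟪b a, R f⟫_ℂ * (1 + lam a) = ⟪b a, f⟫_ℂ := by
    intro a f
    have h1 : ⟪b a, R f⟫_ℂ = ⟪R (b a), f⟫_ℂ := (hsymm (b a) f).symm
    have hconj : conj a.1 * (1 + (lam a : ℂ)) = 1 := by
      have := congrArg conj (hlam a)
      simpa using this
    rw [h1, hRb, inner_smul_left]
    linear_combination ⟪b a, f⟫_ℂ * hconj
  -- The equation `D⋆D u = w` is `(1 + D⋆D) u = u + w`. For uniqueness, the difference of two
  -- solutions lies in `V` and is orthogonal to `V` in the graph inner product, hence to itself.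
  have hchar : (∃ h : u ∈ V, ∀ v : V, ⟪D v, D ⟨u, h⟩⟫_ℂ = ⟪(v : H), w⟫_ℂ) ↔ R (u + w) = u := by
    constructor
    · rintro ⟨h, hv⟩
      have hmem : R (u + w) - u ∈ V := V.sub_mem (hRV _) h
      have key : ∀ v : V, ⟪(v : H), R (u + w) - u⟫_ℂ + ⟪D v, D ⟨_, hmem⟩⟫_ℂ = 0 := by
        intro v
        have e : (⟨R (u + w) - u, hmem⟩ : V) = ⟨R (u + w), hRV _⟩ - ⟨u, h⟩ := rfl
        rw [e, map_sub, inner_sub_right, inner_sub_right, hv v]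
        have := hR (u + w) v
        rw [inner_add_right] at this
        linear_combination this
      have h0 := key ⟨_, hmem⟩
      rw [inner_self_eq_norm_sq_to_K, inner_self_eq_norm_sq_to_K] at h0
      have h0' : ‖R (u + w) - u‖ ^ 2 + ‖D ⟨_, hmem⟩‖ ^ 2 = 0 := by
        refine Complex.ofReal_injective ?_
        push_cast
        exact h0
      have : ‖R (u + w) - u‖ ^ 2 = 0 := by
        nlinarith [sq_nonneg ‖R (u + w) - u‖, sq_nonneg ‖D ⟨_, hmem⟩‖]
      exact sub_eq_zero.1 (norm_eq_zero.1 (pow_eq_zero_iff two_ne_zero |>.1 this))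
    · intro h
      have hu : u ∈ V := h ▸ hRV _
      refine ⟨hu, fun v => ?_⟩
      have e : (⟨R (u + w), hRV _⟩ : V) = ⟨u, hu⟩ := Subtype.ext h
      have := hR (u + w) v
      rw [e, h, inner_add_right] at this
      linear_combination this
  rw [hchar]
  constructor
  · intro h a
    have := hinner a (u + w)
    rw [h, inner_add_right] at this
    linear_combination -this
  · intro h
    refine b.repr.injective (lp.ext ?_)
    funext a
    rw [b.repr_apply_apply, b.repr_apply_apply]
    have h1 := hinner a (u + w)
    rw [inner_add_right, h a] at h1
    have hne : (1 + lam a : ℂ) ≠ 0 := by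
      intro h0
      have := hlam a
      rw [h0] at this
      simp at this
    refine mul_right_cancel₀ hne ?_
    rw [h1]
    ring

end Abstract

end

section

/-! ### Spectral measure of an operator that is diagonal in an orthonormal basis -/

section Spectral

variable {H : Type*} [NormedAddCommGroup H] [InnerProductSpace ℂ H] {ι : Type*}

theorem HilbertBasis.ext_inner (b : HilbertBasis ι ℂ H) {x y : H}
    (h : ∀ i, ⟪b i, x⟫_ℂ = ⟪b i, y⟫_ℂ) : x = y := by
  refine b.repr.injective (lp.ext ?_)
  funext i
  rw [b.repr_apply_apply, b.repr_apply_apply, h i]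

theorem HilbertBasis.hasSum_norm_sq (b : HilbertBasis ι ℂ H) (x : H) :
    HasSum (fun i => ‖⟪b i, x⟫_ℂ‖ ^ 2) (‖x‖ ^ 2) := by
  have h := RCLike.hasSum_re ℂ (b.hasSum_inner_mul_inner x x)
  rw [inner_self_eq_norm_sq] at h
  refine h.congr_fun fun i => ?_
  rw [← inner_conj_symm x (b i), RCLike.conj_mul]
  norm_cast

theorem HilbertBasis.exists_inner_eq (b : HilbertBasis ι ℂ H) {c : ι → ℂ}
    (hc : Summable fun i => ‖c i‖ ^ 2) : ∃ x : H, ∀ i, ⟪b i, x⟫_ℂ = c i := by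
  have hm : Memℓp c 2 := by
    rw [memℓp_gen_iff (by norm_num)]
    simpa using hc
  refine ⟨b.repr.symm ⟨c, hm⟩, fun i => ?_⟩
  rw [← b.repr_apply_apply]
  simp

variable [CompleteSpace H]

/-- The projection onto the closed span of the vectors `b i` with `lam i ∈ s`. -/
def diagProj (b : HilbertBasis ι ℂ H) (lam : ι → ℝ) (s : Set ℝ) : H →L[ℂ] H :=
  -- Written as the complement of the remaining eigenvectors, the subspace is closed without taking
  -- a closure.
  (Submodule.span ℂ (b '' {i | lam i ∉ s}))ᗮ.starProjection

theorem inner_diagProj (b : HilbertBasis ι ℂ H) (lam : ι → ℝ) (s : Set ℝ) (i : ι) (x : H) :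
    ⟪b i, diagProj b lam s x⟫_ℂ = {i | lam i ∈ s}.indicator (fun i => ⟪b i, x⟫_ℂ) i := by
  classical
  unfold diagProj
  rw [← Submodule.inner_starProjection_left_eq_right]
  by_cases h : lam i ∈ s
  · rw [indicator_of_mem (by exact h), Submodule.starProjection_eq_self_iff.2]
    rw [Submodule.mem_orthogonal]
    intro y hy
    induction hy using Submodule.span_induction with
    | mem y hy =>
      obtain ⟨j, hj, rfl⟩ := hy
      refine b.orthonormal.2 ?_
      rintro rfl
      exact hj h
    | zero => simp
    | add y z _ _ hy hz => rw [inner_add_left, hy, hz, add_zero]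
    | smul c y _ hy => rw [inner_smul_left, hy, mul_zero]
  · rw [indicator_of_notMem (by exact h), (Submodule.starProjection_apply_eq_zero_iff _).2,
      inner_zero_left]
    exact Submodule.le_orthogonal_orthogonal _ (Submodule.subset_span ⟨i, h, rfl⟩)

/-- The operator that is diagonal in an orthonormal basis has the expected spectral measure. -/
theorem isSpectralMeasure_diagProj (b : HilbertBasis ι ℂ H) (lam : ι → ℝ) (A : H →ₗ.[ℂ] H)
    (hA : ∀ u w : H, (u, w) ∈ A.graph ↔ ∀ i, ⟪b i, w⟫_ℂ = lam i * ⟪b i, u⟫_ℂ) :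
    IsSpectralMeasure A (diagProj b lam) where
  isStarProjection s _ := isStarProjection_starProjection
  univ := by
    ext x
    refine HilbertBasis.ext_inner b fun i => ?_
    rw [inner_diagProj, indicator_of_mem (by simp)]
    rfl
  inter s t _ _ := by
    ext x
    refine HilbertBasis.ext_inner b fun i => ?_
    rw [mul_apply_eq_comp, inner_diagProj, inner_diagProj]
    by_cases h1 : lam i ∈ s <;> by_cases h2 : lam i ∈ t <;>
      simp [indicator, inner_diagProj, h1, h2]
  integral x := by
    have hdom : x ∈ A.domain ↔ Summable fun i => ‖(lam i : ℂ) * ⟪b i, x⟫_ℂ‖ ^ 2 := by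
      constructor
      · intro hx
        have h := (hA x (A ⟨x, hx⟩)).1 (A.mem_graph ⟨x, hx⟩)
        refine (HilbertBasis.hasSum_norm_sq b (A ⟨x, hx⟩)).summable.congr fun i => ?_
        rw [h i]
      · intro h
        obtain ⟨w, hw⟩ := HilbertBasis.exists_inner_eq b h
        have := (hA x w).2 hw
        rw [LinearPMap.mem_graph_iff] at this
        obtain ⟨y, hy, -⟩ := this
        simp only at hy
        rw [← hy]
        exact y.2
    -- The measure `m_x` puts the mass `|(b i, x)|²` at each eigenvalue `lam i`.
    let m : Measure ℝ :=
      Measure.sum fun i => ENNReal.ofReal (‖⟪b i, x⟫_ℂ‖ ^ 2) • Measure.dirac (lam i)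
    have hm : ∀ f : ℝ → ℝ≥0∞, ∫⁻ t, f t ∂m =
        ∑' i, ENNReal.ofReal (‖⟪b i, x⟫_ℂ‖ ^ 2) * f (lam i) := by
      intro f
      rw [lintegral_sum_measure]
      simp
    refine ⟨m, fun s hs => ?_, ?_, fun hx => ?_⟩
    · have h := HilbertBasis.hasSum_norm_sq b (diagProj b lam s x)
      rw [← h.tsum_eq, ENNReal.ofReal_tsum_of_nonneg (fun i => by positivity) h.summable,
        ← lintegral_indicator_one hs, hm]
      refine tsum_congr fun i => ?_
      rw [inner_diagProj]
      by_cases h : lam i ∈ s <;> simp [indicator, h]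
    · rw [hdom, hm]
      have e : ∀ i, ENNReal.ofReal (‖⟪b i, x⟫_ℂ‖ ^ 2) * ENNReal.ofReal (lam i ^ 2) =
          ENNReal.ofReal (‖(lam i : ℂ) * ⟪b i, x⟫_ℂ‖ ^ 2) := by
        intro i
        rw [← ENNReal.ofReal_mul (by positivity), norm_mul, mul_pow, Complex.norm_real,
          Real.norm_eq_abs, sq_abs, mul_comm]
      simp only [e]
      constructor
      · intro h
        rw [← ENNReal.ofReal_tsum_of_nonneg (fun i => by positivity) h]
        exact ENNReal.ofReal_lt_top
      · intro h
        have := ENNReal.summable_toReal h.ne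
        refine this.congr fun i => ?_
        rw [ENNReal.toReal_ofReal (by positivity)]
    · have h := (hA x (A ⟨x, hx⟩)).1 (A.mem_graph ⟨x, hx⟩)
      have hs := hdom.1 hx
      have h2 := (HilbertBasis.hasSum_norm_sq b x).summable
      have hint : Integrable (fun t : ℝ => t) m := by
        refine ⟨measurable_id.aestronglyMeasurable, ?_⟩
        rw [HasFiniteIntegral, hm]
        -- The first moment is finite because `|t| ≤ (1 + t²)/2` and the moments of orders zero and
        -- two are.
        have hsum := ((h2.add hs).div_const 2)
        refine lt_of_le_of_lt (ENNReal.tsum_le_tsum fun i => ?_)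
          (hsum.tsum_ofReal_lt_top)
        rw [← ofReal_norm, ← ENNReal.ofReal_mul (by positivity)]
        refine ENNReal.ofReal_le_ofReal ?_
        rw [norm_mul, Complex.norm_real]
        nlinarith [mul_nonneg (sq_nonneg ‖⟪b i, x⟫_ℂ‖) (sq_nonneg (1 - ‖lam i‖))]
      have h3 := hasSum_integral_measure hint
      have h4 := RCLike.hasSum_ofReal ℂ |>.2 h3
      refine (b.hasSum_inner_mul_inner x (A ⟨x, hx⟩)).unique (h4.congr_fun fun i => ?_)
      rw [h i, integral_smul_measure, integral_dirac, ENNReal.toReal_ofReal (by positivity),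
        ← inner_conj_symm x (b i), smul_eq_mul]
      push_cast
      rw [mul_left_comm, RCLike.conj_mul]
      simp [mul_comm]

end Spectral

/-! ### The form on the range of a spectral projection and on its complement -/

section Threshold

variable {H K : Type*} [NormedAddCommGroup H] [InnerProductSpace ℂ H] [CompleteSpace H]
  [NormedAddCommGroup K] [InnerProductSpace ℂ K] {ι : Type*}
  {V : Submodule ℂ H} {D : V →ₗ[ℂ] K} {b : HilbertBasis ι ℂ H} {lam : ι → ℝ}

/-- The vectors in the range of the spectral projection for `[0, c]` belong to the operator
domain. -/
theorem diagProj_Icc_mem (hlam : ∀ i, 0 ≤ lam i)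
    (hD : ∀ u w : H, (∃ h : u ∈ V, ∀ v : V, ⟪D v, D ⟨u, h⟩⟫_ℂ = ⟪(v : H), w⟫_ℂ) ↔
        ∀ i, ⟪b i, w⟫_ℂ = lam i * ⟪b i, u⟫_ℂ) (c : ℝ) (x : H) :
    ∃ (w : H) (h : diagProj b lam (Icc 0 c) x ∈ V),
      (∀ v : V, ⟪D v, D ⟨_, h⟩⟫_ℂ = ⟪(v : H), w⟫_ℂ) ∧
      (∀ i, ⟪b i, w⟫_ℂ = lam i * ⟪b i, diagProj b lam (Icc 0 c) x⟫_ℂ) := by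
  have hs : Summable fun i => ‖(lam i : ℂ) * ⟪b i, diagProj b lam (Icc 0 c) x⟫_ℂ‖ ^ 2 := by
    refine Summable.of_nonneg_of_le (fun i => by positivity) (fun i => ?_)
      ((HilbertBasis.hasSum_norm_sq b x).summable.mul_left (c ^ 2))
    rw [inner_diagProj]
    by_cases h : lam i ∈ Icc 0 c
    · rw [indicator_of_mem (by exact h), norm_mul, mul_pow, Complex.norm_real, Real.norm_eq_abs,
        sq_abs]
      have := hlam i
      gcongr
      exact h.2
    · rw [indicator_of_notMem (by exact h), mul_zero, norm_zero, zero_pow two_ne_zero]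
      positivity
  obtain ⟨w, hw⟩ := HilbertBasis.exists_inner_eq b hs
  obtain ⟨h, hv⟩ := (hD _ w).2 hw
  exact ⟨w, h, hv, hw⟩

/-- Testing the weak equation with `u` itself gives `‖D u‖² = ∑ lam i |(b i, u)|²`, and only indices
with `lam i ≤ c` contribute. -/
theorem norm_sq_form_diagProj_le (hlam : ∀ i, 0 ≤ lam i)
    (hD : ∀ u w : H, (∃ h : u ∈ V, ∀ v : V, ⟪D v, D ⟨u, h⟩⟫_ℂ = ⟪(v : H), w⟫_ℂ) ↔
        ∀ i, ⟪b i, w⟫_ℂ = lam i * ⟪b i, u⟫_ℂ) {c : ℝ} {u : H}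
    (hu : diagProj b lam (Icc 0 c) u = u) : ∃ h : u ∈ V, ‖D ⟨u, h⟩‖ ^ 2 ≤ c * ‖u‖ ^ 2 := by
  obtain ⟨w, h, h1, h2⟩ := diagProj_Icc_mem hlam hD c u
  have hu' : u ∈ V := by rw [← hu]; exact h
  refine ⟨hu', ?_⟩
  have e : (⟨_, h⟩ : V) = ⟨u, hu'⟩ := Subtype.ext hu
  have h3 := h1 ⟨u, hu'⟩
  rw [e] at h3
  simp only [hu] at h2
  have h4 := RCLike.hasSum_re ℂ (b.hasSum_inner_mul_inner u w)
  have h5 := congrArg RCLike.re h3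
  rw [inner_self_eq_norm_sq] at h5
  rw [h5]
  refine hasSum_le (fun i => ?_) h4 ((HilbertBasis.hasSum_norm_sq b u).mul_left c)
  rw [h2 i, mul_left_comm, ← inner_conj_symm u (b i), RCLike.conj_mul]
  have hre : RCLike.re ((lam i : ℂ) * ((‖⟪b i, u⟫_ℂ‖ : ℝ) : ℂ) ^ 2) =
      lam i * ‖⟪b i, u⟫_ℂ‖ ^ 2 := by
    norm_cast
  refine hre.le.trans ?_
  by_cases hi : lam i ∈ Icc 0 c
  · gcongr
    exact hi.2
  · have h6 := inner_diagProj b lam (Icc 0 c) i u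
    rw [hu, indicator_of_notMem (by exact hi)] at h6
    simp [h6]

/-- With `y = x - F x`, the cross term `(D (F x), D y)` vanishes: `F x` lies in the operator domain
and its image has no component along the eigenvectors in `y`. The equality turns a bound for the
form on the pair `(x, y)` into a bound for `‖y‖`. -/
theorem form_diagProj_compl (hlam : ∀ i, 0 ≤ lam i)
    (hD : ∀ u w : H, (∃ h : u ∈ V, ∀ v : V, ⟪D v, D ⟨u, h⟩⟫_ℂ = ⟪(v : H), w⟫_ℂ) ↔
        ∀ i, ⟪b i, w⟫_ℂ = lam i * ⟪b i, u⟫_ℂ) {c : ℝ} (hc : 0 ≤ c) (x : V) :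
    ∃ h : (x : H) - diagProj b lam (Icc 0 c) x ∈ V,
      ⟪D x, D ⟨_, h⟩⟫_ℂ = (‖D ⟨_, h⟩‖ ^ 2 : ℝ) ∧
      c * ‖(x : H) - diagProj b lam (Icc 0 c) x‖ ^ 2 ≤ ‖D ⟨_, h⟩‖ ^ 2 := by
  obtain ⟨w, h, h1, h2⟩ := diagProj_Icc_mem hlam hD c x
  have hmem : (x : H) - diagProj b lam (Icc 0 c) x ∈ V := V.sub_mem x.2 h
  set y := (x : H) - diagProj b lam (Icc 0 c) x with hy
  have hyi : ∀ i, lam i ∈ Icc 0 c → ⟪b i, y⟫_ℂ = 0 := by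
    intro i hi
    rw [hy, inner_sub_right, inner_diagProj, indicator_of_mem (by exact hi), sub_self]
  have horth : ⟪(y : H), w⟫_ℂ = 0 := by
    refine (b.hasSum_inner_mul_inner y w).unique ?_
    convert! hasSum_zero using 2 with i
    by_cases hi : lam i ∈ Icc 0 c
    · rw [← inner_conj_symm, hyi i hi]
      simp
    · rw [h2, inner_diagProj, indicator_of_notMem (by exact hi)]
      simp
  refine ⟨hmem, ?_, ?_⟩
  · have hx : x = ⟨y, hmem⟩ + ⟨_, h⟩ := Subtype.ext (by simp [hy])
    have h3 := h1 ⟨y, hmem⟩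
    rw [horth] at h3
    conv_lhs => rw [hx]
    rw [map_add, inner_add_left, ← inner_conj_symm (D ⟨_, h⟩), h3, map_zero, add_zero,
      inner_self_eq_norm_sq_to_K]
    push_cast
    rfl
  · have hbV : ∀ i, ∃ hi : b i ∈ V, ∀ v : V,
        ⟪D v, D ⟨b i, hi⟩⟫_ℂ = lam i * ⟪(v : H), b i⟫_ℂ := by
      intro i
      obtain ⟨h, hv⟩ := (hD (b i) ((lam i : ℂ) • b i)).2 fun j => by
        rw [inner_smul_right]
        by_cases hij : i = j
        · rw [hij]
        · rw [b.orthonormal.2 (Ne.symm hij), mul_zero, mul_zero]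
      exact ⟨h, fun v => by rw [hv, inner_smul_right]⟩
    choose hbm hbD using hbV
    let κ := {i // lam i ∉ Icc 0 c}
    have hκ : ∀ i : κ, 0 < lam i := fun i => by
      have := i.2
      simp only [mem_Icc, not_and, not_le] at this
      exact lt_of_le_of_lt hc (this (hlam i))
    have hκc : ∀ i : κ, c ≤ lam i := fun i => by
      have := i.2
      simp only [mem_Icc, not_and, not_le] at this
      exact (this (hlam i)).le
    -- The vector `y` lies in the form domain but perhaps not in the operator domain, so `‖D y‖²` is
    -- bounded below by Bessel's inequality for the orthonormal vectors `D (b i) / √(lam i)`.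
    let g : κ → K := fun i => (((√(lam i))⁻¹ : ℝ) : ℂ) • D ⟨b i, hbm i⟩
    have hsq : ∀ i : κ, (((√(lam i))⁻¹ : ℝ) : ℂ) * (((√(lam i))⁻¹ : ℝ) : ℂ) * lam i = 1 := by
      intro i
      have h0 := hκ i
      norm_cast
      rw [← mul_inv, Real.mul_self_sqrt h0.le, inv_mul_cancel₀ h0.ne']
    have hg : Orthonormal ℂ g := by
      classical
      rw [orthonormal_iff_ite]
      intro i j
      simp only [g]
      rw [inner_smul_left, inner_smul_right, hbD, Complex.conj_ofReal]
      change _ * (_ * (_ * ⟪b i, b j⟫_ℂ)) = _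
      rw [orthonormal_iff_ite.1 b.orthonormal]
      by_cases hij : i = j
      · subst hij
        simp only [if_true]
        linear_combination hsq i
      · have : (i : ι) ≠ j := fun h => hij (Subtype.ext h)
        simp [hij, this]
    have hgy : ∀ i : κ, lam i * ‖⟪b i, y⟫_ℂ‖ ^ 2 = ‖⟪g i, D ⟨y, hmem⟩⟫_ℂ‖ ^ 2 := by
      intro i
      have e : ⟪D ⟨b i, hbm i⟩, D ⟨y, hmem⟩⟫_ℂ = lam i * ⟪b i, y⟫_ℂ := by
        rw [← inner_conj_symm, hbD, map_mul, Complex.conj_ofReal, inner_conj_symm]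
      simp only [g]
      rw [inner_smul_left, e, Complex.conj_ofReal, norm_mul, norm_mul, Complex.norm_real,
        Complex.norm_real, Real.norm_eq_abs, Real.norm_eq_abs, mul_pow, mul_pow, sq_abs, sq_abs,
        inv_pow, Real.sq_sqrt (hκ i).le]
      have := (hκ i).ne'
      field_simp
    have hsum := (HilbertBasis.hasSum_norm_sq b y).mul_left c
    refine le_of_tendsto hsum (Eventually.of_forall fun s => ?_)
    classical
    have hle := hg.sum_inner_products_le (D ⟨y, hmem⟩) (s := s.subtype fun i => lam i ∉ Icc 0 c)
    refine le_trans ?_ hle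
    rw [← Finset.sum_filter_add_sum_filter_not s (fun i => lam i ∉ Icc 0 c)]
    rw [Finset.sum_eq_zero (s := s.filter fun i => ¬ lam i ∉ Icc 0 c), add_zero,
      ← Finset.sum_subtype_eq_sum_filter]
    · refine Finset.sum_le_sum fun i _ => ?_
      rw [← hgy i]
      gcongr
      exact hκc i
    · intro i hi
      rw [hyi i (not_not.1 (Finset.mem_filter.1 hi).2)]
      simp

end Threshold

end

section

/-! ### One-dimensional integrals -/

theorem lintegral_ofReal_eq {S : Set ℝ} (hS : MeasurableSet S) {f : ℝ → ℝ} (hf : IntegrableOn f S)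
    (h0 : ∀ r ∈ S, 0 ≤ f r) : ∫⁻ r in S, ENNReal.ofReal (f r) = ENNReal.ofReal (∫ r in S, f r) :=
  (ofReal_integral_eq_lintegral_ofReal hf ((ae_restrict_iff' hS).2 (Eventually.of_forall h0))).symm

theorem lintegral_Ioi_rpow {a c : ℝ} (ha : a < -1) (hc : 0 < c) :
    ∫⁻ r in Ioi c, ENNReal.ofReal (r ^ a) = ENNReal.ofReal (-c ^ (a + 1) / (a + 1)) := by
  rw [lintegral_ofReal_eq measurableSet_Ioi (integrableOn_Ioi_rpow_of_lt ha hc)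
    (fun r hr => Real.rpow_nonneg (hc.trans hr).le _), integral_Ioi_rpow_of_lt ha hc]

theorem lintegral_Ioc_rpow {a c : ℝ} (ha : -1 < a) (hc : 0 ≤ c) :
    ∫⁻ r in Ioc 0 c, ENNReal.ofReal (r ^ a) = ENNReal.ofReal (c ^ (a + 1) / (a + 1)) := by
  have h : IntegrableOn (fun r : ℝ => r ^ a) (Ioc 0 c) :=
    (intervalIntegrable_iff_integrableOn_Ioc_of_le hc).1
      (intervalIntegral.intervalIntegrable_rpow' ha)
  rw [lintegral_ofReal_eq measurableSet_Ioc h (fun r hr => Real.rpow_nonneg hr.1.le _),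
    ← intervalIntegral.integral_of_le hc, integral_rpow (Or.inl ha),
    Real.zero_rpow (by linarith), sub_zero]

/-- Convergence at `0` needs `α < 2`, convergence at infinity needs `α > 0`. The weight `r^{-1-α}`
is the kernel `r^{-d-α}` times the Jacobian `r^{d-1}`. -/
theorem lintegral_min_one_sq_lt_top {α : ℝ} (h0 : 0 < α) (h2 : α < 2) :
    ∫⁻ r in Ioi (0 : ℝ), ENNReal.ofReal (min 1 (r ^ 2)) * ENNReal.ofReal (r ^ (-1 - α)) < ∞ := by
  rw [← Ioc_union_Ioi_eq_Ioi (zero_le_one' ℝ)]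
  refine (lintegral_union_le _ _ _).trans_lt (ENNReal.add_lt_top.2 ⟨?_, ?_⟩)
  · refine lt_of_le_of_lt (setLIntegral_mono (g := fun r => ENNReal.ofReal (r ^ (1 - α)))
      (by fun_prop) fun r hr => ?_) ?_
    · rw [← ENNReal.ofReal_mul (by positivity)]
      refine ENNReal.ofReal_le_ofReal ?_
      refine (mul_le_mul_of_nonneg_right (min_le_right _ _)
        (Real.rpow_nonneg hr.1.le _)).trans_eq ?_
      rw [← Real.rpow_natCast, ← Real.rpow_add hr.1]
      norm_num
      ring_nf
    · rw [lintegral_Ioc_rpow (by linarith) zero_le_one]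
      exact ENNReal.ofReal_lt_top
  · refine lt_of_le_of_lt (setLIntegral_mono (g := fun r => ENNReal.ofReal (r ^ (-1 - α)))
      (by fun_prop) fun r hr => ?_) ?_
    · refine mul_le_of_le_one_left (by simp) ?_
      rw [← ENNReal.ofReal_one]
      exact ENNReal.ofReal_le_ofReal (min_le_left _ _)
    · rw [lintegral_Ioi_rpow (by linarith) zero_lt_one]
      exact ENNReal.ofReal_lt_top

open scoped Classical in
/-- The order of the threshold estimate. -/
def thresholdRate (α s : ℝ) : ℝ :=
  if α < 1 then s ^ α else if α = 1 then s * (1 + |Real.log s|) else s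

theorem thresholdRate_nonneg {α s : ℝ} (hs : 0 ≤ s) : 0 ≤ thresholdRate α s := by
  unfold thresholdRate
  split_ifs <;> positivity

/-- The source of the three regimes. The integrand is at most `s r^{-α}`, and at most `2 r^{-1-α}`;
the latter integrates to `O(s^α)` beyond `1/s`. Below `1/s` the former gives `O(s^α)` if `α < 1` and
`s ln(1/s)` if `α = 1`. For `α > 1` it is integrable on all of `(1, ∞)` and no cut is needed. -/
theorem exists_lintegral_tail_le {α : ℝ} (h0 : 0 < α) :
    ∃ C : ℝ, 0 ≤ C ∧ ∀ s : ℝ, 0 ≤ s →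
      ∫⁻ r in Ioi (1 : ℝ), ENNReal.ofReal (min 2 (s * r)) * ENNReal.ofReal (r ^ (-1 - α)) ≤
        ENNReal.ofReal (C * thresholdRate α s) := by
  have hlin : ∀ s : ℝ, ∀ r : ℝ, 0 < r →
      ENNReal.ofReal (min 2 (s * r)) * ENNReal.ofReal (r ^ (-1 - α)) ≤
        ENNReal.ofReal s * ENNReal.ofReal (r ^ (-α)) := by
    intro s r hr
    rw [← ENNReal.ofReal_mul' (by positivity), ← ENNReal.ofReal_mul' (by positivity)]
    refine ENNReal.ofReal_le_ofReal ?_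
    refine (mul_le_mul_of_nonneg_right (min_le_right _ _) (by positivity)).trans_eq ?_
    rw [mul_assoc]
    congr 1
    rw [show -α = 1 + (-1 - α) by ring, Real.rpow_add hr, Real.rpow_one]
  have htwo : ∀ s : ℝ, ∀ r : ℝ, 0 < r →
      ENNReal.ofReal (min 2 (s * r)) * ENNReal.ofReal (r ^ (-1 - α)) ≤
        ENNReal.ofReal 2 * ENNReal.ofReal (r ^ (-1 - α)) := by
    intro s r hr
    gcongr
    exact min_le_left _ _
  have htail : ∀ s : ℝ, 0 < s →
      ∫⁻ r in Ioi s⁻¹, ENNReal.ofReal (min 2 (s * r)) * ENNReal.ofReal (r ^ (-1 - α)) ≤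
        ENNReal.ofReal (2 / α * s ^ α) := by
    intro s hs
    refine (setLIntegral_mono (by fun_prop)
      fun r hr => htwo s r ((inv_pos.2 hs).trans (mem_Ioi.1 hr))).trans ?_
    rw [lintegral_const_mul _ (by fun_prop), lintegral_Ioi_rpow (by linarith) (inv_pos.2 hs),
      ← ENNReal.ofReal_mul (by norm_num)]
    refine ENNReal.ofReal_le_ofReal (le_of_eq ?_)
    rw [show -1 - α + 1 = -α by ring, Real.inv_rpow hs.le, Real.rpow_neg hs.le, inv_inv]
    field_simp
  rcases lt_trichotomy α 1 with h1 | h1 | h1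
  · refine ⟨1 / (1 - α) + 2 / α, by have := sub_pos.2 h1; positivity, fun s hs => ?_⟩
    have hα : 0 < 1 - α := by linarith
    rcases hs.eq_or_lt with rfl | hs
    · simp
    have hω : thresholdRate α s = s ^ α := by simp [thresholdRate, h1]
    rw [hω]
    -- Enlarging the domain to `(0, ∞)` is harmless since `r^{-α}` is integrable at `0`, and it
    -- avoids comparing `1/s` with `1`.
    calc _ ≤ ∫⁻ r in Ioc 0 s⁻¹ ∪ Ioi s⁻¹,
          ENNReal.ofReal (min 2 (s * r)) * ENNReal.ofReal (r ^ (-1 - α)) := by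
          refine lintegral_mono_set ?_
          rw [Ioc_union_Ioi_eq_Ioi (inv_pos.2 hs).le]
          exact Ioi_subset_Ioi zero_le_one
      _ ≤ ENNReal.ofReal (1 / (1 - α) * s ^ α) + ENNReal.ofReal (2 / α * s ^ α) := by
          refine (lintegral_union_le _ _ _).trans (add_le_add ?_ (htail s hs))
          refine (setLIntegral_mono (by fun_prop) fun r hr => hlin s r hr.1).trans ?_
          rw [lintegral_const_mul _ (by fun_prop),
            lintegral_Ioc_rpow (by linarith) (inv_pos.2 hs).le, ← ENNReal.ofReal_mul hs.le]
          refine ENNReal.ofReal_le_ofReal (le_of_eq ?_)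
          rw [Real.inv_rpow hs.le, ← Real.rpow_neg hs.le,
            show -(-α + 1) = α - 1 by ring, Real.rpow_sub_one hs.ne',
            show -α + 1 = 1 - α by ring]
          field_simp
      _ = _ := by
          rw [← ENNReal.ofReal_add (by positivity) (by positivity)]
          ring_nf
  · subst h1
    refine ⟨2, by norm_num, fun s hs => ?_⟩
    have hω : thresholdRate 1 s = s * (1 + |Real.log s|) := by simp [thresholdRate]
    rw [hω]
    rcases hs.eq_or_lt with rfl | hs
    · simp
    have hl := abs_nonneg (Real.log s)
    rcases le_total s 1 with hs1 | hs1
    · have hs1' : 1 ≤ s⁻¹ := (one_le_inv₀ hs).2 hs1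
      rw [← Ioc_union_Ioi_eq_Ioi hs1']
      calc _ ≤ ENNReal.ofReal (s * -Real.log s) + ENNReal.ofReal (2 / 1 * s ^ (1 : ℝ)) := by
            refine (lintegral_union_le _ _ _).trans (add_le_add ?_ (htail s hs))
            refine (setLIntegral_mono (by fun_prop)
              fun r hr => hlin s r (zero_lt_one.trans hr.1)).trans ?_
            have hint : IntegrableOn (fun r : ℝ => r⁻¹) (Ioc 1 s⁻¹) := by
              refine (intervalIntegrable_iff_integrableOn_Ioc_of_le hs1').1 ?_
              refine intervalIntegrable_inv_iff.2 (Or.inr ?_)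
              rw [uIcc_of_le hs1']
              simp
            have := lintegral_ofReal_eq measurableSet_Ioc hint
              (fun r hr => inv_nonneg.2 (zero_le_one.trans hr.1.le))
            simp only [Real.rpow_neg_one]
            rw [lintegral_const_mul _ (by fun_prop), this, ← intervalIntegral.integral_of_le hs1',
              integral_inv_of_pos zero_lt_one (inv_pos.2 hs), div_one, Real.log_inv,
              ← ENNReal.ofReal_mul hs.le]
        _ ≤ _ := by
            have h3 : 0 ≤ -Real.log s := by
              have := Real.log_nonpos hs.le hs1
              linarith
            rw [← ENNReal.ofReal_add (by positivity) (by positivity)]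
            refine ENNReal.ofReal_le_ofReal ?_
            rw [Real.rpow_one, abs_of_nonpos (by linarith)]
            nlinarith [mul_nonneg hs.le h3]
    -- For `s ≥ 1` the trivial bound `2∫_1^∞ r^{-2} dr = 2` is already below `2s(1 + |ln s|)`.
    · refine (setLIntegral_mono (by fun_prop)
        fun r hr => htwo s r (zero_lt_one.trans (mem_Ioi.1 hr))).trans ?_
      rw [lintegral_const_mul _ (by fun_prop), lintegral_Ioi_rpow (by linarith) zero_lt_one,
        ← ENNReal.ofReal_mul (by norm_num)]
      refine ENNReal.ofReal_le_ofReal ?_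
      norm_num
      nlinarith
  · refine ⟨1 / (α - 1), by have := sub_pos.2 h1; positivity, fun s hs => ?_⟩
    have hω : thresholdRate α s = s := by
      simp [thresholdRate, h1.not_gt, h1.ne']
    rw [hω]
    refine (setLIntegral_mono (by fun_prop)
      fun r hr => hlin s r (zero_lt_one.trans (mem_Ioi.1 hr))).trans ?_
    rw [lintegral_const_mul _ (by fun_prop), lintegral_Ioi_rpow (by linarith) zero_lt_one,
      ← ENNReal.ofReal_mul hs]
    refine ENNReal.ofReal_le_ofReal (le_of_eq ?_)
    rw [Real.one_rpow, show -α + 1 = -(α - 1) by ring, neg_div_neg_eq]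
    ring

/-! ### Radial integrals -/

/-- Polar coordinates for non-negative functions, with no integrability required. -/
theorem lintegral_fun_norm {E : Type*} [NormedAddCommGroup E] [NormedSpace ℝ E]
    [MeasurableSpace E] [BorelSpace E] [FiniteDimensional ℝ E] [Nontrivial E] (μ : Measure E)
    [μ.IsAddHaarMeasure] {f : ℝ → ℝ≥0∞} (hf : Measurable f) :
    ∫⁻ x, f ‖x‖ ∂μ = Module.finrank ℝ E * μ (Metric.ball 0 1) *
      ∫⁻ r in Ioi (0 : ℝ), ENNReal.ofReal (r ^ (Module.finrank ℝ E - 1)) * f r := by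
  calc ∫⁻ x, f ‖x‖ ∂μ = ∫⁻ x : ({(0)}ᶜ : Set E), f ‖x.1‖ ∂(μ.comap (↑)) := by
        rw [lintegral_subtype_comap (measurableSet_singleton _).compl fun x => f ‖x‖,
          restrict_compl_singleton]
    _ = ∫⁻ x, 1 * f x.2 ∂μ.toSphere.prod (.volumeIoiPow (Module.finrank ℝ E - 1)) := by
        simpa using μ.measurePreserving_homeomorphUnitSphereProd.lintegral_comp_emb
          (Homeomorph.measurableEmbedding _) (f ∘ Subtype.val ∘ Prod.snd)
    _ = _ := by
        rw [lintegral_prod_mul (f := fun _ => 1) (g := fun x : Ioi (0 : ℝ) => f x)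
          (by fun_prop) (by fun_prop), lintegral_const, one_mul, μ.toSphere_apply_univ,
          Measure.volumeIoiPow, lintegral_withDensity_eq_lintegral_mul _ (by fun_prop)
            (by fun_prop)]
        congr 1
        exact lintegral_subtype_comap measurableSet_Ioi
          fun r => ENNReal.ofReal (r ^ (Module.finrank ℝ E - 1)) * f r

variable {d : ℕ}

/-- The kernel `|z|^{-d-α}`. -/
def levyKernel (α : ℝ) (z : Space d) : ℝ≥0∞ := ENNReal.ofReal ((‖z‖ ^ ((d : ℝ) + α))⁻¹)

@[fun_prop]
theorem measurable_levyKernel (α : ℝ) : Measurable (levyKernel (d := d) α) := by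
  unfold levyKernel
  fun_prop

theorem lintegral_radial_levyKernel [NeZero d] (α : ℝ) {f : ℝ → ℝ≥0∞} (hf : Measurable f) :
    ∫⁻ z : Space d, f ‖z‖ * levyKernel α z = (d * volume (Metric.ball (0 : Space d) 1)) *
      ∫⁻ r in Ioi (0 : ℝ), f r * ENNReal.ofReal (r ^ (-1 - α)) := by
  have h := lintegral_fun_norm (volume : Measure (Space d))
    (f := fun r => f r * ENNReal.ofReal ((r ^ ((d : ℝ) + α))⁻¹)) (by fun_prop)
  unfold levyKernel
  rw [h, finrank_euclideanSpace_fin]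
  congr 1
  refine setLIntegral_congr_fun measurableSet_Ioi fun r hr => ?_
  have hr : 0 < r := hr
  have hd : 1 ≤ d := NeZero.one_le
  rw [mul_left_comm, ← ENNReal.ofReal_mul (by positivity)]
  congr 2
  rw [← Real.rpow_natCast, ← Real.rpow_neg hr.le, ← Real.rpow_add hr]
  congr 1
  push_cast [hd]
  ring

theorem ball_const_lt_top :
    (d * volume (Metric.ball (0 : Space d) 1) : ℝ≥0∞) < ∞ :=
  ENNReal.mul_lt_top (by simp) measure_ball_lt_top

theorem lintegral_min_levyKernel_lt_top [NeZero d] {α : ℝ} (h0 : 0 < α) (h2 : α < 2) :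
    ∫⁻ z : Space d, ENNReal.ofReal (min 1 (‖z‖ ^ 2)) * levyKernel α z < ∞ := by
  rw [lintegral_radial_levyKernel α (f := fun r => ENNReal.ofReal (min 1 (r ^ 2))) (by fun_prop)]
  exact ENNReal.mul_lt_top ball_const_lt_top (lintegral_min_one_sq_lt_top h0 h2)

theorem exists_lintegral_far_le [NeZero d] {α : ℝ} (h0 : 0 < α) :
    ∃ C : ℝ, 0 ≤ C ∧ ∀ s : ℝ, 0 ≤ s →
      ∫⁻ z in {z : Space d | 1 < ‖z‖}, ENNReal.ofReal (min 2 (s * ‖z‖)) * levyKernel α z ≤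
        ENNReal.ofReal (C * thresholdRate α s) := by
  obtain ⟨C, hC0, hC⟩ := exists_lintegral_tail_le h0
  refine ⟨(d * volume (Metric.ball (0 : Space d) 1) : ℝ≥0∞).toReal * C, by positivity,
    fun s hs => ?_⟩
  have hS : MeasurableSet {z : Space d | 1 < ‖z‖} := measurableSet_lt (by fun_prop) (by fun_prop)
  have e := lintegral_radial_levyKernel (d := d) α
    (f := (Ioi 1).indicator fun r => ENNReal.ofReal (min 2 (s * r)))
    (Measurable.indicator (by fun_prop) measurableSet_Ioi)
  have e1 : ∀ z : Space d, (Ioi 1).indicator (fun r => ENNReal.ofReal (min 2 (s * r))) ‖z‖ *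
      levyKernel α z = {z : Space d | 1 < ‖z‖}.indicator
        (fun z => ENNReal.ofReal (min 2 (s * ‖z‖)) * levyKernel α z) z := by
    intro z
    by_cases h : 1 < ‖z‖ <;> simp [indicator, h]
  have e2 : ∀ r : ℝ, (Ioi 1).indicator (fun r => ENNReal.ofReal (min 2 (s * r))) r *
      ENNReal.ofReal (r ^ (-1 - α)) = (Ioi 1).indicator
        (fun r => ENNReal.ofReal (min 2 (s * r)) * ENNReal.ofReal (r ^ (-1 - α))) r := by
    intro r
    by_cases h : 1 < r <;> simp [indicator, h]
  simp only [e1, e2] at e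
  rw [lintegral_indicator hS, lintegral_indicator measurableSet_Ioi,
    Measure.restrict_restrict measurableSet_Ioi,
    inter_eq_left.2 (Ioi_subset_Ioi (zero_le_one' ℝ))] at e
  rw [e, mul_assoc _ C, ENNReal.ofReal_mul ENNReal.toReal_nonneg,
    ENNReal.ofReal_toReal ball_const_lt_top.ne]
  gcongr
  exact hC s hs

/-! ### The symbol of the fractional Laplacian -/

theorem norm_exp_sub_one_sq (t : ℝ) :
    ‖Complex.exp (Complex.I * t) - 1‖ ^ 2 = 2 * (1 - Real.cos t) := by
  rw [Complex.norm_exp_I_mul_ofReal_sub_one, Real.norm_eq_abs, sq_abs, mul_pow,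
    Real.sin_sq_eq_half_sub, mul_div_cancel₀ t two_ne_zero]
  ring

theorem norm_exp_sub_one_le_two (t : ℝ) : ‖Complex.exp (Complex.I * t) - 1‖ ≤ 2 := by
  refine (norm_sub_le _ _).trans ?_
  rw [Complex.norm_exp_I_mul_ofReal, norm_one]
  norm_num

theorem norm_exp_inner_sub_one_le (k z : Space d) :
    ‖Complex.exp (Complex.I * (⟪k, z⟫_ℝ : ℝ)) - 1‖ ≤ ‖k‖ * ‖z‖ :=
  Real.norm_exp_I_mul_ofReal_sub_one_le.trans (norm_inner_le_norm k z)

theorem norm_exp_inner_sub_one_sq_le (k z : Space d) :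
    ‖Complex.exp (Complex.I * (⟪k, z⟫_ℝ : ℝ)) - 1‖ ^ 2 ≤ (4 + ‖k‖ ^ 2) * min 1 (‖z‖ ^ 2) := by
  have h1 := norm_exp_inner_sub_one_le k z
  have h2 := norm_exp_sub_one_le_two ⟪k, z⟫_ℝ
  have h0 := norm_nonneg (Complex.exp (Complex.I * (⟪k, z⟫_ℝ : ℝ)) - 1)
  rcases min_cases 1 (‖z‖ ^ 2) with ⟨h, -⟩ | ⟨h, -⟩ <;> rw [h]
  · nlinarith [sq_nonneg ‖k‖]
  · have := pow_le_pow_left₀ h0 h1 2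
    nlinarith [sq_nonneg ‖z‖]

theorem integrable_symbol [NeZero d] {α : ℝ} (h0 : 0 < α) (h2 : α < 2) (k : Space d) :
    Integrable fun z : Space d => (1 - Real.cos ⟪k, z⟫_ℝ) / ‖z‖ ^ ((d : ℝ) + α) := by
  refine ⟨Measurable.aestronglyMeasurable (by fun_prop), ?_⟩
  have hfin := ENNReal.mul_lt_top (ENNReal.ofReal_lt_top (r := 4 + ‖k‖ ^ 2))
    (lintegral_min_levyKernel_lt_top (d := d) h0 h2)
  rw [← lintegral_const_mul _ (by fun_prop)] at hfin
  refine lt_of_le_of_lt (lintegral_mono fun z => ?_) hfin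
  rw [levyKernel, ← ENNReal.ofReal_mul (by positivity), ← ENNReal.ofReal_mul (by positivity),
    ← ofReal_norm]
  refine ENNReal.ofReal_le_ofReal ?_
  have h := norm_exp_inner_sub_one_sq_le k z
  rw [norm_exp_sub_one_sq] at h
  have hc : 0 ≤ 1 - Real.cos ⟪k, z⟫_ℝ := sub_nonneg.2 (Real.cos_le_one _)
  rw [Real.norm_of_nonneg (div_nonneg hc (by positivity))]
  rw [div_eq_mul_inv, ← mul_assoc]
  gcongr
  linarith

/-- Substitution `z ↦ t z`: the kernel contributes `t^{d+α}` and the volume `t^{-d}`. -/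
theorem integral_symbol_single [NeZero d] {α t : ℝ} (ht : 0 < t) :
    ∫ z : Space d, (1 - Real.cos (t * z 0)) / ‖z‖ ^ ((d : ℝ) + α) = t ^ α * c0 d α := by
  have h := Measure.integral_comp_smul (volume : Measure (Space d))
    (fun z : Space d => (1 - Real.cos (z 0)) / ‖z‖ ^ ((d : ℝ) + α)) t
  have e : ∀ z : Space d, (1 - Real.cos (t * z 0)) / ‖z‖ ^ ((d : ℝ) + α) =
      t ^ ((d : ℝ) + α) * ((1 - Real.cos ((t • z) 0)) / ‖t • z‖ ^ ((d : ℝ) + α)) := by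
    intro z
    rw [norm_smul, Real.norm_of_nonneg ht.le, Real.mul_rpow ht.le (norm_nonneg z)]
    have : t ^ ((d : ℝ) + α) ≠ 0 := (Real.rpow_pos_of_pos ht _).ne'
    rw [mul_div_assoc', mul_div_mul_left _ _ this]
    simp
  simp only [e]
  rw [integral_const_mul, h, finrank_euclideanSpace_fin, abs_of_pos (by positivity), smul_eq_mul,
    ← mul_assoc, Real.rpow_add ht, Real.rpow_natCast, ← c0]
  have : t ^ d ≠ 0 := by positivity
  field_simp

/-- The kernel is rotation invariant, so a reflection that sends `k` to `|k| e₀` reduces the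
integral to the scaled one-coordinate case. -/
theorem integral_symbol [NeZero d] {α : ℝ} (h0 : 0 < α) (k : Space d) :
    ∫ z : Space d, (1 - Real.cos ⟪k, z⟫_ℝ) / ‖z‖ ^ ((d : ℝ) + α) = ‖k‖ ^ α * c0 d α := by
  rcases eq_or_ne k 0 with rfl | hk
  · simp [Real.zero_rpow h0.ne']
  · have hk' : 0 < ‖k‖ := norm_pos_iff.2 hk
    rw [← integral_symbol_single hk']
    let e : Space d := EuclideanSpace.single 0 ‖k‖
    have hnorm : ‖k‖ = ‖e‖ := by simp [e]
    let ρ := (Submodule.span ℝ {k - e})ᗮ.reflection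
    have hρ : ρ k = e := Submodule.reflection_sub hnorm
    rw [← ρ.measurePreserving.integral_comp ρ.toHomeomorph.measurableEmbedding
      (fun z : Space d => (1 - Real.cos (‖k‖ * z 0)) / ‖z‖ ^ ((d : ℝ) + α))]
    refine integral_congr_ae (Eventually.of_forall fun z => ?_)
    simp only
    rw [ρ.norm_map, ← ρ.inner_map_map k z, hρ]
    simp [e, EuclideanSpace.inner_single_left, mul_comm]

theorem c0_pos [NeZero d] {α : ℝ} (h0 : 0 < α) (h2 : α < 2) : 0 < c0 d α := by
  have hint := integrable_symbol h0 h2 (EuclideanSpace.single (0 : Fin d) (1 : ℝ))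
  simp only [EuclideanSpace.inner_single_left, map_one, one_mul] at hint
  have hnn : ∀ z : Space d, 0 ≤ (1 - Real.cos (z 0)) / ‖z‖ ^ ((d : ℝ) + α) := fun z =>
    div_nonneg (sub_nonneg.2 (Real.cos_le_one _)) (by positivity)
  rw [c0, integral_pos_iff_support_of_nonneg hnn hint]
  -- On this open set `cos z₀ < 1`, so the non-negative integrand is strictly positive there.
  let U : Set (Space d) := {z | 0 < z 0 ∧ z 0 < 1}
  have hU : IsOpen U := by
    refine IsOpen.and (isOpen_lt (by fun_prop) (by fun_prop))
      (isOpen_lt (by fun_prop) (by fun_prop))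
  have hne : U.Nonempty := ⟨EuclideanSpace.single 0 (1 / 2), by simp [U]; norm_num⟩
  refine (hU.measure_pos volume hne).trans_le (measure_mono fun z hz => ?_)
  have hz0 : z ≠ 0 := by
    rintro rfl
    exact lt_irrefl _ hz.1
  have hcos : Real.cos (z 0) < 1 := by
    rw [← Real.cos_zero]
    exact Real.cos_lt_cos_of_nonneg_of_le_pi_div_two le_rfl
      (by linarith [hz.2, Real.pi_gt_three]) hz.1
  have : 0 < ‖z‖ := norm_pos_iff.2 hz0
  exact (div_pos (sub_pos.2 hcos) (Real.rpow_pos_of_pos this _)).ne'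

theorem lintegral_symbol [NeZero d] {α : ℝ} (h0 : 0 < α) (h2 : α < 2) (k : Space d) :
    ∫⁻ z : Space d, ENNReal.ofReal (‖Complex.exp (Complex.I * (⟪k, z⟫_ℝ : ℝ)) - 1‖ ^ 2) *
      levyKernel α z = ENNReal.ofReal (2 * (‖k‖ ^ α * c0 d α)) := by
  have h := ofReal_integral_eq_lintegral_ofReal (integrable_symbol h0 h2 k)
    (Eventually.of_forall fun z => div_nonneg (sub_nonneg.2 (Real.cos_le_one _)) (by positivity))
  rw [integral_symbol h0] at h
  rw [ENNReal.ofReal_mul zero_le_two, h, ← lintegral_const_mul _ (by fun_prop)]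
  refine lintegral_congr fun z => ?_
  rw [levyKernel, ← ENNReal.ofReal_mul (by positivity), ← ENNReal.ofReal_mul zero_le_two,
    norm_exp_sub_one_sq, div_eq_mul_inv, mul_assoc]

end

section

variable {d : ℕ}

/-! ### The cell and the torus -/

theorem lintegral_norm_sq_Lp {X : Type*} [MeasurableSpace X] {m : Measure X} (f : Lp ℂ 2 m) :
    ∫⁻ x, ENNReal.ofReal (‖f x‖ ^ 2) ∂m = ENNReal.ofReal (‖f‖ ^ 2) := by
  have h := inner_self_eq_norm_sq_to_K (𝕜 := ℂ) f
  have hi := L2.integrable_inner (𝕜 := ℂ) f f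
  rw [L2.inner_def] at h
  have e : ∀ x, ⟪f x, f x⟫_ℂ = ((‖f x‖ ^ 2 : ℝ) : ℂ) := fun x => by
    rw [inner_self_eq_norm_sq_to_K]
    push_cast
    rfl
  simp only [e] at h hi
  rw [integral_complex_ofReal] at h
  have h' : ∫ x, ‖f x‖ ^ 2 ∂m = ‖f‖ ^ 2 := by
    refine Complex.ofReal_injective (h.trans ?_)
    push_cast
    rfl
  rw [← h', ofReal_integral_eq_lintegral_ofReal]
  · exact hi.re.congr (Eventually.of_forall fun x => Complex.ofReal_re _)
  · exact Eventually.of_forall fun x => by positivity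

theorem toCell_of_mem {x : Space d} (hx : x ∈ cell d) : toCell x = x := by
  ext i
  exact Int.fract_eq_self.2 ⟨(hx i).1, (hx i).2⟩

theorem ae_mem_cell : ∀ᵐ x ∂(cellMeasure d), x ∈ cell d :=
  ae_restrict_mem (measurableSet_cell d)

theorem ae_toCell_eq : ∀ᵐ x ∂(cellMeasure d), toCell x = x :=
  ae_mem_cell.mono fun _ => toCell_of_mem

/-- A property that holds almost everywhere on the cell holds almost everywhere for
representatives. -/
theorem quasiMeasurePreserving_toCell :
    Measure.QuasiMeasurePreserving (toCell (d := d)) volume (cellMeasure d) := by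
  refine ⟨measurable_toCell, Measure.AbsolutelyContinuous.mk fun s hs h0 => ?_⟩
  rw [Measure.map_apply measurable_toCell hs]
  have h1 : s.indicator (fun _ => (1 : ℂ)) =ᵐ[cellMeasure d] fun _ => 0 :=
    indicator_meas_zero h0
  have h2 := periodicExt_congr h1
  refine measure_mono_null (fun x hx => ?_) (ae_iff.1 h2)
  change ¬ s.indicator (fun _ => (1 : ℂ)) (toCell x) = 0
  rw [indicator_of_mem (mem_preimage.1 hx)]
  exact one_ne_zero

/-- The Haar probability measure of the torus. -/
def torusMeasure (d : ℕ) : Measure (UnitAddTorus (Fin d)) :=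
  Measure.pi fun _ => AddCircle.haarAddCircle

instance : IsProbabilityMeasure (torusMeasure d) := by
  unfold torusMeasure
  infer_instance

instance : (torusMeasure d).IsAddRightInvariant := by
  unfold torusMeasure
  infer_instance

/-- The projection of `ℝ^d` onto the torus. -/
def toTorus (x : Space d) : UnitAddTorus (Fin d) := fun i => (x i : UnitAddCircle)

/-- The section of `toTorus` with values in the cell. -/
def ofTorus (t : UnitAddTorus (Fin d)) : Space d :=
  WithLp.toLp 2 fun i => (AddCircle.equivIco (1 : ℝ) 0 (t i) : ℝ)

theorem ofTorus_toTorus (x : Space d) : ofTorus (toTorus x) = toCell x := by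
  ext i
  change ((AddCircle.equivIco (1 : ℝ) 0 (x i : UnitAddCircle)) : ℝ) = Int.fract (x i)
  rw [AddCircle.coe_equivIco_mk_apply]
  simp

theorem toTorus_ofTorus (t : UnitAddTorus (Fin d)) : toTorus (ofTorus t) = t := by
  ext i
  exact (AddCircle.equivIco (1 : ℝ) 0).symm_apply_apply (t i)

theorem toTorus_add (x y : Space d) : toTorus (x + y) = toTorus x + toTorus y := by
  ext i
  rfl

theorem measurable_ofTorus : Measurable (ofTorus (d := d)) := by
  refine (WithLp.measurable_toLp 2 _).comp (measurable_pi_lambda _ fun i => ?_)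
  exact (measurable_subtype_coe.comp (AddCircle.measurableEquivIco (1 : ℝ) 0).measurable).comp
    (measurable_pi_apply i)

theorem measurePreserving_toTorus :
    MeasurePreserving (toTorus (d := d)) (cellMeasure d) (torusMeasure d) := by
  have h1 : MeasurePreserving (WithLp.ofLp : Space d → Fin d → ℝ) (cellMeasure d)
      (volume.restrict (univ.pi fun _ => Ico 0 1)) := by
    have e : cell d = (WithLp.ofLp : Space d → Fin d → ℝ) ⁻¹' (univ.pi fun _ => Ico 0 1) := by
      ext x
      simp [cell]
    rw [cellMeasure, e]
    exact (PiLp.volume_preserving_ofLp (Fin d)).restrict_preimage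
      (MeasurableSet.univ_pi fun _ => measurableSet_Ico)
  have h2 : MeasurePreserving ((↑) : ℝ → UnitAddCircle) (volume.restrict (Ico 0 1))
      AddCircle.haarAddCircle := by
    have h := AddCircle.measurePreserving_mk (1 : ℝ) 0
    rw [AddCircle.volume_eq_smul_haarAddCircle, ENNReal.ofReal_one, one_smul, zero_add] at h
    rwa [restrict_Ico_eq_restrict_Ioc]
  rw [volume_pi, Measure.restrict_pi_pi] at h1
  exact (measurePreserving_pi _ _ fun _ => h2).comp h1

theorem measurePreserving_ofTorus :
    MeasurePreserving (ofTorus (d := d)) (torusMeasure d) (cellMeasure d) := by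
  refine ⟨measurable_ofTorus, ?_⟩
  rw [← measurePreserving_toTorus.map_eq,
    Measure.map_map measurable_ofTorus measurePreserving_toTorus.measurable]
  have h : (ofTorus ∘ toTorus) =ᵐ[cellMeasure d] id := by
    filter_upwards [ae_toCell_eq] with x hx
    rw [Function.comp_apply, ofTorus_toTorus, hx, id]
  rw [Measure.map_congr h, Measure.map_id]

/-- The shift modulo `ℤ^d` is conjugate to a translation of the torus, which preserves Haar measure.
-/
theorem measurePreserving_toCell_add (z : Space d) :
    MeasurePreserving (fun x => toCell (x + z)) (cellMeasure d) (cellMeasure d) := by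
  have h := (measurePreserving_ofTorus.comp
    (measurePreserving_add_right (torusMeasure d) (toTorus z))).comp measurePreserving_toTorus
  have e : (ofTorus ∘ (fun t => t + toTorus z)) ∘ toTorus = fun x : Space d => toCell (x + z) := by
    funext x
    simp only [Function.comp_apply]
    rw [← toTorus_add, ofTorus_toTorus]
  rwa [e] at h

/-! ### Fourier series on the cell -/

/-- The frequency `2πn` of the dual lattice. -/
def dualVec (n : Fin d → ℤ) : Space d := (2 * Real.pi) • latticeVec n

/-- The Fourier basis of the `L₂` space of the torus. -/
def torusBasis : HilbertBasis (Fin d → ℤ) ℂ (Lp ℂ 2 (torusMeasure d)) :=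
  UnitAddTorus.mFourierBasis

theorem coeFn_torusBasis (n : Fin d → ℤ) :
    torusBasis n =ᵐ[torusMeasure d] UnitAddTorus.mFourier n := by
  have h : (torusBasis n : Lp ℂ 2 (torusMeasure d)) = UnitAddTorus.mFourierLp 2 n :=
    congrFun UnitAddTorus.coe_mFourierBasis n
  rw [h]
  exact UnitAddTorus.coeFn_mFourierLp 2 n

theorem mFourier_toTorus (n : Fin d → ℤ) (x : Space d) :
    UnitAddTorus.mFourier n (toTorus x) =
      Complex.exp (Complex.I * (⟪dualVec n, x⟫_ℝ : ℝ)) := by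
  change ∏ i, fourier (n i) ((x i : ℝ) : UnitAddCircle) = _
  simp only [fourier_coe_apply]
  rw [← Complex.exp_sum]
  congr 1
  simp only [dualVec, latticeVec, inner_smul_left, PiLp.inner_apply]
  simp only [RCLike.inner_apply, conj_trivial]
  push_cast
  rw [Finset.mul_sum, Finset.mul_sum]
  refine Finset.sum_congr rfl fun i _ => ?_
  ring

/-- The characters `e^{i⟨2πn, x⟩}` as elements of `L₂(Ω)`. -/
def cellChar (n : Fin d → ℤ) : L2Cell d :=
  Lp.compMeasurePreservingₗᵢ ℂ toTorus measurePreserving_toTorus (torusBasis n)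

theorem coeFn_cellChar (n : Fin d → ℤ) :
    cellChar n =ᵐ[cellMeasure d] fun x =>
      Complex.exp (Complex.I * (⟪dualVec n, x⟫_ℝ : ℝ)) := by
  have h := Lp.coeFn_compMeasurePreserving (torusBasis n)
    (measurePreserving_toTorus (d := d))
  refine h.trans ?_
  filter_upwards [measurePreserving_toTorus.quasiMeasurePreserving.ae (coeFn_torusBasis n)]
    with x hx
  rw [Function.comp_apply, hx, mFourier_toTorus]

theorem exp_dualVec_toCell (n : Fin d → ℤ) (x : Space d) :
    Complex.exp (Complex.I * (⟪dualVec n, toCell x⟫_ℝ : ℝ)) =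
      Complex.exp (Complex.I * (⟪dualVec n, x⟫_ℝ : ℝ)) := by
  rw [← mFourier_toTorus, ← mFourier_toTorus, ← ofTorus_toTorus, toTorus_ofTorus]

theorem orthonormal_cellChar : Orthonormal ℂ (cellChar (d := d)) :=
  torusBasis.orthonormal.comp_linearIsometry
    (Lp.compMeasurePreservingₗᵢ ℂ toTorus measurePreserving_toTorus)

/-- Completeness is inherited from the torus: `toTorus` and `ofTorus` are inverse to each other
almost everywhere, so every `u` is the pullback of some `v` with the same Fourier coefficients. -/
theorem eq_zero_of_inner_cellChar {u : L2Cell d} (hu : ∀ n, ⟪cellChar n, u⟫_ℂ = 0) : u = 0 := by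
  let v : Lp ℂ 2 (torusMeasure d) :=
    Lp.compMeasurePreservingₗᵢ ℂ ofTorus measurePreserving_ofTorus u
  let S := Lp.compMeasurePreservingₗᵢ (p := 2) (E := ℂ) ℂ (toTorus (d := d))
    measurePreserving_toTorus
  have hv : S v = u := by
    refine Lp.ext ?_
    have h1 := Lp.coeFn_compMeasurePreserving v (measurePreserving_toTorus (d := d))
    have h2 := Lp.coeFn_compMeasurePreserving u (measurePreserving_ofTorus (d := d))
    refine h1.trans ?_
    filter_upwards [measurePreserving_toTorus.quasiMeasurePreserving.ae h2, ae_toCell_eq]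
      with x hx hx'
    change v (toTorus x) = u x
    refine hx.trans ?_
    rw [Function.comp_apply, ofTorus_toTorus, hx']
  have hv0 : v = 0 := by
    refine HilbertBasis.ext_inner torusBasis fun n => ?_
    have := hu n
    rw [← hv] at this
    rw [inner_zero_right, ← this]
    exact (S.inner_map_map _ _).symm
  rw [← hv, hv0, map_zero]

/-- The Fourier basis of `L₂(Ω)`. -/
def cellBasis : HilbertBasis (Fin d → ℤ) ℂ (L2Cell d) :=
  HilbertBasis.mkOfOrthogonalEqBot orthonormal_cellChar (by
    rw [Submodule.eq_bot_iff]
    intro u hu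
    exact eq_zero_of_inner_cellChar fun n =>
      Submodule.inner_right_of_mem_orthogonal (Submodule.subset_span (mem_range_self n)) hu)

theorem coe_cellBasis : ⇑(cellBasis (d := d)) = cellChar :=
  HilbertBasis.coe_mkOfOrthogonalEqBot _ _

/-- Translations of periodic functions. -/
def translate (z : Space d) : L2Cell d →ₗᵢ[ℂ] L2Cell d :=
  Lp.compMeasurePreservingₗᵢ ℂ (fun x => toCell (x + z)) (measurePreserving_toCell_add z)

theorem coeFn_translate (z : Space d) (u : L2Cell d) :
    translate z u =ᵐ[cellMeasure d] fun x => periodicExt u (x + z) :=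
  Lp.coeFn_compMeasurePreserving u (measurePreserving_toCell_add z)

theorem norm_exp_I_inner (k z : Space d) :
    ‖Complex.exp (Complex.I * (⟪k, z⟫_ℝ : ℝ))‖ = 1 := Complex.norm_exp_I_mul_ofReal _

theorem translate_cellChar (z : Space d) (n : Fin d → ℤ) :
    translate z (cellChar n) =
      Complex.exp (Complex.I * (⟪dualVec n, z⟫_ℝ : ℝ)) • cellChar n := by
  refine Lp.ext ?_
  have h := (measurePreserving_toCell_add z).quasiMeasurePreserving.ae (coeFn_cellChar n)
  filter_upwards [coeFn_translate z (cellChar n), h, coeFn_cellChar n,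
    Lp.coeFn_smul (Complex.exp (Complex.I * (⟪dualVec n, z⟫_ℝ : ℝ))) (cellChar n)]
    with x h1 h2 h3 h4
  rw [h1, periodicExt, h2, h4, Pi.smul_apply, h3, exp_dualVec_toCell, smul_eq_mul,
    ← Complex.exp_add, inner_add_right]
  congr 1
  push_cast
  ring

theorem inner_cellChar_translate (z : Space d) (n : Fin d → ℤ) (u : L2Cell d) :
    ⟪cellChar n, translate z u⟫_ℂ =
      Complex.exp (Complex.I * (⟪dualVec n, z⟫_ℝ : ℝ)) * ⟪cellChar n, u⟫_ℂ := by
  have h := (translate z).inner_map_map (cellChar n) u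
  rw [translate_cellChar, inner_smul_left] at h
  rw [← h, ← mul_assoc, Complex.mul_conj, Complex.normSq_eq_norm_sq, norm_exp_I_inner]
  simp

/-- Parseval's identity for the increments of a quasi-periodic function. -/
theorem lintegral_bloch_add_sub (ξ z : Space d) (u : L2Cell d) :
    ∫⁻ x, ENNReal.ofReal (‖bloch ξ u x - bloch ξ u (x + z)‖ ^ 2) ∂(cellMeasure d) =
      ∑' n, ENNReal.ofReal (‖⟪cellChar n, u⟫_ℂ‖ ^ 2) * ENNReal.ofReal
        (‖Complex.exp (Complex.I * (⟪ξ + dualVec n, z⟫_ℝ : ℝ)) - 1‖ ^ 2) := by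
  let c := Complex.exp (Complex.I * (⟪ξ, z⟫_ℝ : ℝ))
  have h1 : ∫⁻ x, ENNReal.ofReal (‖bloch ξ u x - bloch ξ u (x + z)‖ ^ 2) ∂(cellMeasure d) =
      ENNReal.ofReal (‖c • translate z u - u‖ ^ 2) := by
    rw [← lintegral_norm_sq_Lp]
    refine lintegral_congr_ae ?_
    filter_upwards [Lp.coeFn_sub (c • translate z u) u, Lp.coeFn_smul c (translate z u),
      coeFn_translate z u, ae_toCell_eq] with x h1 h2 h3 h4
    rw [h1, Pi.sub_apply, h2, Pi.smul_apply, h3, norm_sub_rev]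
    have e : bloch ξ u (x + z) - bloch ξ u x = Complex.exp (Complex.I * (⟪ξ, x⟫_ℝ : ℝ)) *
        (c • periodicExt u (x + z) - u x) := by
      have e1 : periodicExt u x = u x := by rw [periodicExt, h4]
      simp only [bloch, c, e1, smul_eq_mul, inner_add_right]
      push_cast
      rw [mul_add, Complex.exp_add]
      ring
    rw [e, norm_mul, norm_exp_I_inner, one_mul]
  rw [h1, ← (HilbertBasis.hasSum_norm_sq cellBasis _).tsum_eq,
    ENNReal.ofReal_tsum_of_nonneg (fun n => by positivity)
      (HilbertBasis.hasSum_norm_sq cellBasis _).summable]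
  refine tsum_congr fun n => ?_
  rw [← ENNReal.ofReal_mul (by positivity), coe_cellBasis, inner_sub_right, inner_smul_right,
    inner_cellChar_translate, ← mul_pow, ← norm_mul]
  congr 3
  simp only [c, inner_add_left]
  push_cast
  rw [mul_add, Complex.exp_add]
  ring

theorem lintegral_periodicExt_add (u : L2Cell d) (z : Space d) :
    ∫⁻ x, ENNReal.ofReal (‖periodicExt u (x + z)‖ ^ 2) ∂(cellMeasure d) =
      ENNReal.ofReal (‖u‖ ^ 2) := by
  rw [← (translate z).norm_map u, ← lintegral_norm_sq_Lp]
  refine lintegral_congr_ae ?_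
  filter_upwards [coeFn_translate z u] with x h
  rw [h]

end

section

variable {d : ℕ}

/-! ### The energy of a quasi-periodic function -/

theorem norm_sub_sq_le_two (a b : ℂ) : ‖a - b‖ ^ 2 ≤ 2 * ‖a‖ ^ 2 + 2 * ‖b‖ ^ 2 := by
  have h := norm_sub_le a b
  nlinarith [norm_nonneg (a - b), sq_nonneg (‖a‖ - ‖b‖)]

@[fun_prop]
theorem measurable_bloch (ξ : Space d) (u : L2Cell d) : Measurable (bloch ξ u) := by
  unfold bloch
  have := measurable_periodicExt u
  fun_prop

theorem bloch_zero (u : L2Cell d) : bloch 0 u = periodicExt u := by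
  funext x
  simp [bloch]

theorem levyKernel_neg (α : ℝ) (z : Space d) : levyKernel α (-z) = levyKernel α z := by
  simp [levyKernel]

/-- The energy of the quasi-periodic function `e^{i⟨ξ,x⟩} u(x)` for the coefficient `2`. -/
def energy (α : ℝ) (ξ : Space d) (u : L2Cell d) : ℝ≥0∞ :=
  ∫⁻ p, ENNReal.ofReal (‖bloch ξ u p.1 - bloch ξ u p.2‖ ^ 2) * levyKernel α (p.1 - p.2)
    ∂(stripMeasure d)

instance : SFinite (cellMeasure d) := by
  unfold cellMeasure
  infer_instance

/-- The shear `y = x + z` leaves a kernel that depends on `z` only, so that Parseval's identity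
applies in `x` for fixed `z`. -/
theorem lintegral_strip {F : Space d × Space d → ℝ≥0∞} (hF : Measurable F) :
    ∫⁻ p, F p ∂(stripMeasure d) = ∫⁻ z, ∫⁻ x, F (x, x + z) ∂(cellMeasure d) := by
  rw [stripMeasure, lintegral_prod _ hF.aemeasurable]
  refine (lintegral_congr fun x => ?_).trans
    (lintegral_lintegral_swap (f := fun x z => F (x, x + z)) (by fun_prop))
  exact (lintegral_add_left_eq_self (μ := volume) (fun y => F (x, y)) x).symm

/-- For fixed `z`, translation multiplies the coefficient of index `n` by a phase; integrating
`|e^{i⟨ξ+2πn,z⟩} - 1|²` against the kernel gives `2c₀|ξ + 2πn|^α`. -/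
theorem energy_eq_tsum [NeZero d] {α : ℝ} (h0 : 0 < α) (h2 : α < 2) (ξ : Space d) (u : L2Cell d) :
    energy α ξ u = ∑' n, ENNReal.ofReal (‖⟪cellChar n, u⟫_ℂ‖ ^ 2) *
      ENNReal.ofReal (2 * (‖ξ + dualVec n‖ ^ α * c0 d α)) := by
  rw [energy, lintegral_strip (by fun_prop)]
  have e : ∀ z : Space d, ∫⁻ x, ENNReal.ofReal (‖bloch ξ u x - bloch ξ u (x + z)‖ ^ 2) *
      levyKernel α (x - (x + z)) ∂(cellMeasure d) =
      ∑' n, ENNReal.ofReal (‖⟪cellChar n, u⟫_ℂ‖ ^ 2) * (ENNReal.ofReal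
        (‖Complex.exp (Complex.I * (⟪ξ + dualVec n, z⟫_ℝ : ℝ)) - 1‖ ^ 2) * levyKernel α z) := by
    intro z
    have e1 : ∀ x : Space d, levyKernel α (x - (x + z)) = levyKernel α z := fun x => by
      rw [sub_add_cancel_left, levyKernel_neg]
    simp only [e1]
    rw [lintegral_mul_const _ (by fun_prop), lintegral_bloch_add_sub, ← ENNReal.tsum_mul_right]
    simp only [mul_assoc]
  simp only [e]
  rw [lintegral_tsum fun n => by fun_prop]
  refine tsum_congr fun n => ?_
  rw [lintegral_const_mul _ (by fun_prop), lintegral_symbol h0 h2]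

theorem tsum_norm_sq_cellChar (u : L2Cell d) :
    ∑' n, ENNReal.ofReal (‖⟪cellChar n, u⟫_ℂ‖ ^ 2) = ENNReal.ofReal (‖u‖ ^ 2) := by
  have h := HilbertBasis.hasSum_norm_sq cellBasis u
  rw [coe_cellBasis] at h
  rw [← h.tsum_eq, ENNReal.ofReal_tsum_of_nonneg (fun n => by positivity) h.summable]

theorem add_rpow_le_four {α a b : ℝ} (h0 : 0 < α) (h2 : α < 2) (ha : 0 ≤ a) (hb : 0 ≤ b) :
    (a + b) ^ α ≤ 4 * (a ^ α + b ^ α) := by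
  have h4 : (2 : ℝ) ^ α ≤ 4 := by
    calc (2 : ℝ) ^ α ≤ 2 ^ (2 : ℝ) := Real.rpow_le_rpow_of_exponent_le one_le_two h2.le
      _ = 4 := by norm_num
  have key : ∀ x y : ℝ, 0 ≤ x → 0 ≤ y → x ≤ y → (x + y) ^ α ≤ 4 * (x ^ α + y ^ α) := by
    intro x y hx hy hxy
    calc (x + y) ^ α ≤ (2 * y) ^ α := Real.rpow_le_rpow (by positivity) (by linarith) h0.le
      _ = 2 ^ α * y ^ α := Real.mul_rpow zero_le_two hy
      _ ≤ 4 * (x ^ α + y ^ α) := by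
        have := Real.rpow_nonneg hx α
        have := Real.rpow_nonneg hy α
        nlinarith
  rcases le_total a b with h | h
  · exact key a b ha hb h
  · rw [add_comm a, add_comm (a ^ α)]
    exact key b a hb ha h

/-- The form domain does not depend on `ξ`, since `|ξ' + 2πn|^α ≤ 4(|ξ + 2πn|^α + |ξ' - ξ|^α)`. -/
theorem energy_lt_top_of_energy_lt_top [NeZero d] {α : ℝ} (h0 : 0 < α) (h2 : α < 2)
    {ξ ξ' : Space d} {u : L2Cell d} (h : energy α ξ u < ∞) : energy α ξ' u < ∞ := by
  have hc := (c0_pos (d := d) h0 h2).le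
  have hle : energy α ξ' u ≤ ENNReal.ofReal 4 * energy α ξ u +
      ENNReal.ofReal (‖u‖ ^ 2) * ENNReal.ofReal (4 * (2 * (‖ξ' - ξ‖ ^ α * c0 d α))) := by
    rw [energy_eq_tsum h0 h2, energy_eq_tsum h0 h2, ← tsum_norm_sq_cellChar,
      ← ENNReal.tsum_mul_left, ← ENNReal.tsum_mul_right, ← ENNReal.tsum_add]
    refine ENNReal.tsum_le_tsum fun n => ?_
    rw [mul_left_comm (ENNReal.ofReal 4), ← mul_add,
      ← ENNReal.ofReal_mul (show (0 : ℝ) ≤ 4 by norm_num),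
      ← ENNReal.ofReal_add (by positivity) (by positivity)]
    gcongr
    have h3 : ‖ξ' + dualVec n‖ ≤ ‖ξ + dualVec n‖ + ‖ξ' - ξ‖ := by
      rw [show ξ' + dualVec n = (ξ + dualVec n) + (ξ' - ξ) by abel]
      exact norm_add_le _ _
    have h4 := (Real.rpow_le_rpow (norm_nonneg _) h3 h0.le).trans
      (add_rpow_le_four h0 h2 (norm_nonneg _) (norm_nonneg _))
    have := mul_le_mul_of_nonneg_right h4 hc
    linarith
  refine hle.trans_lt (ENNReal.add_lt_top.2 ⟨?_, ?_⟩)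
  · exact ENNReal.mul_lt_top ENNReal.ofReal_lt_top h
  · exact ENNReal.mul_lt_top ENNReal.ofReal_lt_top ENNReal.ofReal_lt_top

/-! ### The energy and the Sobolev space -/

theorem toCell_add_latticeVec (x : Space d) (n : Fin d → ℤ) :
    toCell (x + latticeVec n) = toCell x := by
  ext i
  simp [toCell, latticeVec]

theorem periodicExt_add_latticeVec (u : Space d → ℂ) (x : Space d) (n : Fin d → ℤ) :
    periodicExt u (x + latticeVec n) = periodicExt u x := by
  rw [periodicExt, toCell_add_latticeVec, periodicExt]

/-- Integrals of periodic functions over balls are controlled by integrals over the cell. -/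
theorem exists_lintegral_ball_le (R : ℝ) : ∃ N : ℕ, ∀ f : Space d → ℝ≥0∞,
    (∀ x n, f (x + latticeVec n) = f x) →
      ∫⁻ x in Metric.ball 0 R, f x ≤ N * ∫⁻ x, f x ∂(cellMeasure d) := by
  let M : ℤ := ⌈R⌉
  let T : Finset (Fin d → ℤ) := Fintype.piFinset fun _ => Finset.Icc (-M - 1) (M + 1)
  refine ⟨T.card, fun f hf => ?_⟩
  have hcov : Metric.ball (0 : Space d) R ⊆ ⋃ n ∈ T, (· + latticeVec n) ⁻¹' cell d := by
    intro x hx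
    rw [mem_ball_zero_iff] at hx
    simp only [mem_iUnion]
    refine ⟨fun i => -⌊x i⌋, ?_, ?_⟩
    · refine Fintype.mem_piFinset.2 fun i => ?_
      have h1 : |x i| < R := lt_of_le_of_lt (by
        rw [← Real.norm_eq_abs]; exact PiLp.norm_apply_le x i) hx
      rw [abs_lt] at h1
      have h2 : R ≤ M := Int.le_ceil R
      have h3 : ⌊x i⌋ ≤ M + 1 := by
        have := Int.floor_le (x i)
        have : (⌊x i⌋ : ℝ) ≤ M := by linarith
        have : ⌊x i⌋ ≤ M := by exact_mod_cast this
        omega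
      have h4 : -M - 1 ≤ ⌊x i⌋ := by
        have := Int.lt_floor_add_one (x i)
        have h5 : (-M - 1 : ℝ) < ⌊x i⌋ := by linarith
        have : -M - 1 < ⌊x i⌋ := by exact_mod_cast h5
        omega
      rw [Finset.mem_Icc]
      omega
    · rw [mem_preimage, ← toCell_eq]
      exact toCell_mem x
  have hfin : ∀ T : Finset (Fin d → ℤ), ∫⁻ x in ⋃ n ∈ T, (· + latticeVec n) ⁻¹' cell d, f x ≤
      ∑ n ∈ T, ∫⁻ x in (· + latticeVec n) ⁻¹' cell d, f x := by
    classical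
    intro T
    induction T using Finset.induction_on with
    | empty => simp
    | insert a T ha ih =>
      rw [Finset.set_biUnion_insert, Finset.sum_insert ha]
      exact (lintegral_union_le _ _ _).trans (add_le_add le_rfl ih)
  calc ∫⁻ x in Metric.ball 0 R, f x
      ≤ ∫⁻ x in ⋃ n ∈ T, (· + latticeVec n) ⁻¹' cell d, f x := lintegral_mono_set hcov
    _ ≤ ∑ n ∈ T, ∫⁻ x in (· + latticeVec n) ⁻¹' cell d, f x := hfin T
    _ = ∑ n ∈ T, ∫⁻ x, f x ∂(cellMeasure d) := by
        refine Finset.sum_congr rfl fun n _ => ?_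
        rw [cellMeasure, ← (measurePreserving_add_right volume
          (latticeVec n)).setLIntegral_comp_preimage_emb (measurableEmbedding_addRight _) f (cell d)]
        simp only [hf]
    _ = T.card * ∫⁻ x, f x ∂(cellMeasure d) := by
        rw [Finset.sum_const, nsmul_eq_mul]

theorem gagliardo_eq {α : ℝ} (U : Set (Space d)) (u : L2Cell d) :
    gagliardo (α / 2) U (periodicExt u) = ∫⁻ p in U ×ˢ U,
      ENNReal.ofReal (‖bloch 0 u p.1 - bloch 0 u p.2‖ ^ 2) * levyKernel α (p.1 - p.2) := by
  unfold gagliardo levyKernel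
  refine lintegral_congr fun p => ?_
  rw [← ENNReal.ofReal_mul (by positivity), bloch_zero, div_eq_mul_inv,
    mul_div_cancel₀ α two_ne_zero]

theorem memHsLoc_of_energy {α : ℝ} {u : L2Cell d} (h : energy α 0 u < ∞) :
    MemHsLoc (α / 2) (periodicExt u) := by
  intro R
  obtain ⟨N, hN⟩ := exists_lintegral_ball_le (d := d) R
  have hmeas := measurable_periodicExt u
  refine ⟨?_, ?_⟩
  · rw [memLp_two_iff_integrable_sq_norm hmeas.aestronglyMeasurable]
    refine ⟨Measurable.aestronglyMeasurable (by fun_prop), ?_⟩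
    have h1 := hN (fun x => ‖‖periodicExt u x‖ ^ 2‖ₑ)
      (fun x n => by rw [periodicExt_add_latticeVec])
    refine h1.trans_lt (ENNReal.mul_lt_top (by simp) ?_)
    have h2 := lintegral_periodicExt_add u 0
    simp only [add_zero] at h2
    have e : ∀ x : Space d, ‖‖periodicExt u x‖ ^ 2‖ₑ =
        ENNReal.ofReal (‖periodicExt u x‖ ^ 2) := fun x =>
      Real.enorm_of_nonneg (by positivity)
    simp only [e, h2]
    exact ENNReal.ofReal_lt_top
  · rw [gagliardo_eq]
    let F : Space d × Space d → ℝ≥0∞ := fun p =>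
      ENNReal.ofReal (‖bloch 0 u p.1 - bloch 0 u p.2‖ ^ 2) * levyKernel α (p.1 - p.2)
    have hF : Measurable F := by fun_prop
    have h1 := hN (fun x => ∫⁻ y, F (x, y)) (fun x n => by
      rw [← lintegral_add_right_eq_self (fun y => F (x + latticeVec n, y)) (latticeVec n)]
      refine lintegral_congr fun y => ?_
      simp only [F, bloch_zero, periodicExt_add_latticeVec, add_sub_add_right_eq_sub])
    have h2 : ∫⁻ x, (∫⁻ y, F (x, y)) ∂(cellMeasure d) = energy α 0 u := by
      rw [energy, stripMeasure, lintegral_prod _ hF.aemeasurable]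
    rw [h2] at h1
    have h3 : ∫⁻ p in Metric.ball 0 R ×ˢ Metric.ball 0 R, F p ≤
        ∫⁻ x in Metric.ball 0 R, ∫⁻ y, F (x, y) := by
      rw [← lintegral_prod _ hF.aemeasurable]
      refine lintegral_mono' ?_ le_rfl
      rw [Measure.volume_eq_prod, ← Measure.prod_restrict]
      exact Measure.prod_mono le_rfl Measure.restrict_le_self
    exact (h3.trans h1).trans_lt (ENNReal.mul_lt_top (by simp) h)

/-- Pairs with `|x - y| > 1` cost at most a multiple of `‖u‖²`, uniformly over shifts. The other
pairs, with `x` in the cell, lie in a fixed ball, where the local Sobolev energy is finite. -/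
theorem energy_lt_top_of_memHsLoc [NeZero d] {α : ℝ} (h0 : 0 < α) (h2 : α < 2) {u : L2Cell d}
    (h : MemHsLoc (α / 2) (periodicExt u)) : energy α 0 u < ∞ := by
  let F : Space d × Space d → ℝ≥0∞ := fun p =>
    ENNReal.ofReal (‖bloch 0 u p.1 - bloch 0 u p.2‖ ^ 2) * levyKernel α (p.1 - p.2)
  have hF : Measurable F := by fun_prop
  have hmeas := measurable_periodicExt u
  let S : Set (Space d × Space d) := {p | 1 < ‖p.1 - p.2‖}
  have hS : MeasurableSet S := measurableSet_lt (by fun_prop) (by fun_prop)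
  change ∫⁻ p, F p ∂(stripMeasure d) < ∞
  rw [← lintegral_add_compl F hS]
  refine ENNReal.add_lt_top.2 ⟨?_, ?_⟩
  · rw [← lintegral_indicator hS, lintegral_strip (hF.indicator hS)]
    have hle : ∀ z : Space d, ∫⁻ x, S.indicator F (x, x + z) ∂(cellMeasure d) ≤
        ENNReal.ofReal (4 * ‖u‖ ^ 2) *
          (ENNReal.ofReal (min 1 (‖z‖ ^ 2)) * levyKernel α z) := by
      intro z
      by_cases hz : 1 < ‖z‖
      -- The term `x + 0` lets both summands be treated by translation invariance.
      · have e : ∀ x, S.indicator F (x, x + z) ≤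
            (ENNReal.ofReal 2 * ENNReal.ofReal (‖periodicExt u (x + 0)‖ ^ 2) +
            ENNReal.ofReal 2 * ENNReal.ofReal (‖periodicExt u (x + z)‖ ^ 2)) *
              levyKernel α z := by
          intro x
          rw [indicator_of_mem (by simpa [S] using hz)]
          simp only [F]
          rw [sub_add_cancel_left, levyKernel_neg, bloch_zero, add_zero,
            ← ENNReal.ofReal_mul zero_le_two, ← ENNReal.ofReal_mul zero_le_two,
            ← ENNReal.ofReal_add (by positivity) (by positivity)]
          gcongr
          exact norm_sub_sq_le_two _ _
        refine (lintegral_mono e).trans ?_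
        rw [lintegral_mul_const _ (by fun_prop), lintegral_add_left (by fun_prop),
          lintegral_const_mul _ (by fun_prop), lintegral_const_mul _ (by fun_prop),
          lintegral_periodicExt_add, lintegral_periodicExt_add, min_eq_left (by nlinarith),
          ENNReal.ofReal_one, one_mul, ← ENNReal.ofReal_mul zero_le_two,
          ← ENNReal.ofReal_add (by positivity) (by positivity)]
        refine le_of_eq ?_
        congr 2
        ring
      · have e : ∀ x, S.indicator F (x, x + z) = 0 := fun x =>
          indicator_of_notMem (by simpa [S] using hz) _
        simp [e]
    refine (lintegral_mono hle).trans_lt ?_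
    rw [lintegral_const_mul _ (by fun_prop)]
    exact ENNReal.mul_lt_top ENNReal.ofReal_lt_top (lintegral_min_levyKernel_lt_top h0 h2)
  · obtain ⟨R, hR⟩ : ∃ R : ℝ, ∀ x ∈ cell d, ‖x‖ ≤ R := by
      refine ⟨√d, fun x hx => ?_⟩
      rw [EuclideanSpace.norm_eq]
      refine Real.sqrt_le_sqrt ?_
      calc ∑ i, ‖x i‖ ^ 2 ≤ ∑ _i : Fin d, (1 : ℝ) := by
            refine Finset.sum_le_sum fun i _ => ?_
            have h := hx i
            rw [Real.norm_eq_abs, sq_abs]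
            nlinarith [h.1, h.2]
        _ = (d : ℝ) := by simp
    have hg := (h (R + 2)).2
    rw [gagliardo_eq] at hg
    refine lt_of_le_of_lt ?_ hg
    have e : stripMeasure d = (volume : Measure (Space d × Space d)).restrict
        (cell d ×ˢ univ) := by
      rw [stripMeasure, cellMeasure, Measure.volume_eq_prod, ← Measure.prod_restrict,
        Measure.restrict_univ]
    rw [e, Measure.restrict_restrict hS.compl]
    refine lintegral_mono_set ?_
    rintro ⟨x, y⟩ ⟨h1, h2, -⟩
    have h1 : ‖x - y‖ ≤ 1 := by simpa [S] using h1
    have h3 := hR x h2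
    have h4 : ‖y‖ ≤ ‖x‖ + ‖x - y‖ := by
      rw [norm_sub_rev]
      simpa using norm_add_le x (y - x)
    refine ⟨mem_ball_zero_iff.2 (by simp only; linarith),
      mem_ball_zero_iff.2 (by simp only; linarith)⟩

theorem mem_periodicSobolev_iff [NeZero d] {α : ℝ} (h0 : 0 < α) (h2 : α < 2) (ξ : Space d)
    (u : L2Cell d) : u ∈ periodicSobolev d (α / 2) ↔ energy α ξ u < ∞ :=
  ⟨fun h => energy_lt_top_of_energy_lt_top h0 h2 (energy_lt_top_of_memHsLoc h0 h2 h),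
    fun h => memHsLoc_of_energy (energy_lt_top_of_energy_lt_top h0 h2 h)⟩

theorem cellChar_mem_periodicSobolev [NeZero d] {α : ℝ} (h0 : 0 < α) (h2 : α < 2)
    (n : Fin d → ℤ) : cellChar n ∈ periodicSobolev d (α / 2) := by
  rw [mem_periodicSobolev_iff h0 h2 0, energy_eq_tsum h0 h2, tsum_eq_single n]
  · exact ENNReal.mul_lt_top ENNReal.ofReal_lt_top ENNReal.ofReal_lt_top
  · intro m hm
    rw [orthonormal_cellChar.2 hm]
    simp

theorem dense_periodicSobolev [NeZero d] {α : ℝ} (h0 : 0 < α) (h2 : α < 2) :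
    Dense (periodicSobolev d (α / 2) : Set (L2Cell d)) := by
  have h := (cellBasis (d := d)).dense_span
  rw [← Submodule.dense_iff_topologicalClosure_eq_top] at h
  refine h.mono ?_
  change Submodule.span ℂ _ ≤ _
  rw [Submodule.span_le, coe_cellBasis]
  rintro _ ⟨n, rfl⟩
  exact cellChar_mem_periodicSobolev h0 h2 n

end

section

/-! ### The operator `D` with `a(ξ; α, μ)[u, v] = (D u, D v)` -/

variable {d : ℕ} {α μminus μplus : ℝ} {μ : Space d → Space d → ℝ}

/-- The weighted difference `(μ(x,y) / 2|x-y|^{d+α})^{1/2} (e^{i⟨ξ,x⟩}u(x) - e^{i⟨ξ,y⟩}u(y))`. -/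
def diffFn (α : ℝ) (μ : Space d → Space d → ℝ) (ξ : Space d) (u : L2Cell d)
    (p : Space d × Space d) : ℂ :=
  (√(μ p.1 p.2 / (2 * ‖p.1 - p.2‖ ^ ((d : ℝ) + α))) : ℝ) * (bloch ξ u p.1 - bloch ξ u p.2)

theorem stripMeasure_absolutelyContinuous :
    stripMeasure d ≪ (volume : Measure (Space d × Space d)) := by
  rw [stripMeasure, cellMeasure, Measure.volume_eq_prod]
  exact Measure.AbsolutelyContinuous.prod Measure.absolutelyContinuous_restrict
    Measure.AbsolutelyContinuous.rfl

theorem IsCoefficient.aestronglyMeasurable_diffFn (hμ : IsCoefficient μminus μplus μ)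
    (ξ : Space d) (u : L2Cell d) :
    AEStronglyMeasurable (diffFn α μ ξ u) (stripMeasure d) := by
  have h1 : AEMeasurable (fun p : Space d × Space d => μ p.1 p.2) (stripMeasure d) :=
    (hμ.aestronglyMeasurable.mono_ac stripMeasure_absolutelyContinuous).aemeasurable
  unfold diffFn
  refine AEMeasurable.aestronglyMeasurable ?_
  refine AEMeasurable.mul ?_ (by fun_prop)
  exact Complex.measurable_ofReal.comp_aemeasurable
    ((h1.div (by fun_prop)).sqrt)

theorem IsCoefficient.ae_bounds (hμ : IsCoefficient μminus μplus μ) :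
    ∀ᵐ p ∂(stripMeasure d), μminus ≤ μ p.1 p.2 ∧ μ p.1 p.2 ≤ μplus :=
  stripMeasure_absolutelyContinuous.ae_le hμ.bounds

theorem norm_sq_diffFn {ξ : Space d} {u : L2Cell d} {p : Space d × Space d}
    (h : 0 ≤ μ p.1 p.2) : ENNReal.ofReal (‖diffFn α μ ξ u p‖ ^ 2) =
      ENNReal.ofReal (μ p.1 p.2 / 2) *
        (ENNReal.ofReal (‖bloch ξ u p.1 - bloch ξ u p.2‖ ^ 2) * levyKernel α (p.1 - p.2)) := by
  rw [levyKernel, ← ENNReal.ofReal_mul (by positivity), ← ENNReal.ofReal_mul (by positivity),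
    diffFn, norm_mul, mul_pow, Complex.norm_real, Real.norm_eq_abs, sq_abs,
    Real.sq_sqrt (by positivity), div_mul_eq_div_div, div_eq_mul_inv (μ p.1 p.2 / 2)]
  congr 1
  ring

theorem IsCoefficient.lintegral_diffFn_le (hμ : IsCoefficient μminus μplus μ)
    (h0 : 0 < μminus) (ξ : Space d) (u : L2Cell d) :
    ∫⁻ p, ENNReal.ofReal (‖diffFn α μ ξ u p‖ ^ 2) ∂(stripMeasure d) ≤
      ENNReal.ofReal (μplus / 2) * energy α ξ u := by
  rw [energy, ← lintegral_const_mul _ (by fun_prop)]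
  refine lintegral_mono_ae ?_
  filter_upwards [hμ.ae_bounds] with p hp
  rw [norm_sq_diffFn (h0.le.trans hp.1)]
  gcongr
  exact hp.2

theorem IsCoefficient.le_lintegral_diffFn (hμ : IsCoefficient μminus μplus μ)
    (h0 : 0 < μminus) (ξ : Space d) (u : L2Cell d) :
    ENNReal.ofReal (μminus / 2) * energy α ξ u ≤
      ∫⁻ p, ENNReal.ofReal (‖diffFn α μ ξ u p‖ ^ 2) ∂(stripMeasure d) := by
  rw [energy, ← lintegral_const_mul _ (by fun_prop)]
  refine lintegral_mono_ae ?_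
  filter_upwards [hμ.ae_bounds] with p hp
  rw [norm_sq_diffFn (h0.le.trans hp.1)]
  gcongr
  exact hp.1

theorem memLp_two_of_lintegral_lt_top {X : Type*} [MeasurableSpace X] {m : Measure X} {f : X → ℂ}
    (hf : AEStronglyMeasurable f m) (h : ∫⁻ x, ENNReal.ofReal (‖f x‖ ^ 2) ∂m < ∞) :
    MemLp f 2 m := by
  rw [memLp_two_iff_integrable_sq_norm hf]
  refine ⟨hf.norm.pow 2, ?_⟩
  refine lt_of_eq_of_lt (lintegral_congr fun x => ?_) h
  exact Real.enorm_of_nonneg (by positivity)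

theorem IsCoefficient.memLp_diffFn [NeZero d] (hμ : IsCoefficient μminus μplus μ)
    (hpos : 0 < μminus) (h0 : 0 < α) (h2 : α < 2) (ξ : Space d) {u : L2Cell d}
    (hu : u ∈ periodicSobolev d (α / 2)) : MemLp (diffFn α μ ξ u) 2 (stripMeasure d) :=
  memLp_two_of_lintegral_lt_top (hμ.aestronglyMeasurable_diffFn ξ u)
    ((hμ.lintegral_diffFn_le hpos ξ u).trans_lt
      (ENNReal.mul_lt_top ENNReal.ofReal_lt_top ((mem_periodicSobolev_iff h0 h2 ξ u).1 hu)))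

theorem diffFn_add (α : ℝ) (μ : Space d → Space d → ℝ) (ξ : Space d) (u v : L2Cell d) :
    diffFn α μ ξ (u + v) =ᵐ[stripMeasure d] diffFn α μ ξ u + diffFn α μ ξ v := by
  filter_upwards [ae_strip (periodicExt_add u v)] with p hp
  simp only [diffFn, bloch, Pi.add_apply, hp.1, hp.2]
  ring

theorem diffFn_smul (α : ℝ) (μ : Space d → Space d → ℝ) (ξ : Space d) (c : ℂ) (u : L2Cell d) :
    diffFn α μ ξ (c • u) =ᵐ[stripMeasure d] c • diffFn α μ ξ u := by
  filter_upwards [ae_strip (periodicExt_smul c u)] with p hp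
  simp only [diffFn, bloch, Pi.smul_apply, smul_eq_mul, hp.1, hp.2]
  ring

/-- The operator `D` with `a(ξ; α, μ)[u, v] = (D u, D v)`. -/
def diffOp [NeZero d] (hμ : IsCoefficient μminus μplus μ) (hpos : 0 < μminus) (h0 : 0 < α)
    (h2 : α < 2) (ξ : Space d) :
    periodicSobolev d (α / 2) →ₗ[ℂ] Lp ℂ 2 (stripMeasure d) where
  toFun u := (hμ.memLp_diffFn hpos h0 h2 ξ u.2).toLp
  map_add' u v := by
    rw [← MemLp.toLp_add, MemLp.toLp_eq_toLp_iff]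
    exact diffFn_add α μ ξ u v
  map_smul' c u := by
    rw [RingHom.id_apply, ← MemLp.toLp_const_smul, MemLp.toLp_eq_toLp_iff]
    exact diffFn_smul α μ ξ c u

theorem norm_latticeVec_ge (n : Fin d → ℤ) (i : Fin d) : |(n i : ℝ)| ≤ ‖latticeVec n‖ := by
  have := PiLp.norm_apply_le (latticeVec n) i
  simpa [latticeVec] using this

theorem norm_dualVec_ge (n : Fin d → ℤ) (i : Fin d) :
    2 * Real.pi * |(n i : ℝ)| ≤ ‖dualVec n‖ := by
  rw [dualVec, norm_smul, Real.norm_of_nonneg (by positivity)]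
  have := norm_latticeVec_ge n i
  gcongr

theorem pi_le_norm_add_dualVec {ξ : Space d} (hξ : ‖ξ‖ ≤ Real.pi) {n : Fin d → ℤ} (hn : n ≠ 0) :
    Real.pi ≤ ‖ξ + dualVec n‖ := by
  obtain ⟨i, hi⟩ := Function.ne_iff.1 hn
  have h1 : (1 : ℝ) ≤ |(n i : ℝ)| := by
    have := Int.one_le_abs hi
    exact_mod_cast this
  have h2 := norm_dualVec_ge n i
  have h3 : ‖dualVec n‖ ≤ ‖ξ + dualVec n‖ + ‖ξ‖ := by
    simpa using norm_sub_le (ξ + dualVec n) ξ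
  nlinarith [Real.pi_pos]

theorem oneCell_eq_cellChar : oneCell d = cellChar 0 := by
  refine Lp.ext ?_
  refine indicatorConstLp_coeFn.trans ?_
  filter_upwards [coeFn_cellChar (0 : Fin d → ℤ), ae_mem_cell] with x h1 h2
  rw [h1, indicator_of_mem h2]
  have : dualVec (0 : Fin d → ℤ) = 0 := by
    ext i
    simp [dualVec, latticeVec]
  simp [this]

theorem exists_subseq_ae_tendsto {X : Type*} [MeasurableSpace X] {m : Measure X}
    {f : ℕ → Lp ℂ 2 m} {g : Lp ℂ 2 m} (h : Tendsto f atTop (𝓝 g)) :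
    ∃ φ : ℕ → ℕ, StrictMono φ ∧ ∀ᵐ x ∂m, Tendsto (fun n => f (φ n) x) atTop (𝓝 (g x)) :=
  (tendstoInMeasure_of_tendsto_Lp h).exists_seq_tendsto_ae

theorem IsCoefficient.ae_formIntegrand_eq (hμ : IsCoefficient μminus μplus μ) (hpos : 0 < μminus)
    (ξ : Space d) (u v : L2Cell d) : ∀ᵐ p ∂(stripMeasure d),
    formIntegrand α μ ξ u v p = 2 * (diffFn α μ ξ u p * conj (diffFn α μ ξ v p)) := by
  filter_upwards [hμ.ae_bounds] with p hp
  have hm : 0 ≤ μ p.1 p.2 := hpos.le.trans hp.1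
  have hsq : (√(μ p.1 p.2 / (2 * ‖p.1 - p.2‖ ^ ((d : ℝ) + α)))) *
      (√(μ p.1 p.2 / (2 * ‖p.1 - p.2‖ ^ ((d : ℝ) + α)))) =
      μ p.1 p.2 / ‖p.1 - p.2‖ ^ ((d : ℝ) + α) / 2 := by
    rw [Real.mul_self_sqrt (by positivity), div_div, mul_comm 2]
  have hsq' := congrArg (fun r : ℝ => (r : ℂ)) hsq
  simp only [formIntegrand, diffFn, map_mul, Complex.conj_ofReal]
  push_cast at hsq' ⊢
  linear_combination (-2 * (bloch ξ u p.1 - bloch ξ u p.2) *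
    (conj (bloch ξ v p.1 - bloch ξ v p.2))) * hsq'

section diffOp

variable [NeZero d] (hμ : IsCoefficient μminus μplus μ) (hpos : 0 < μminus) (h0 : 0 < α)
  (h2 : α < 2) (ξ : Space d)

theorem coeFn_diffOp (u : periodicSobolev d (α / 2)) :
    diffOp hμ hpos h0 h2 ξ u =ᵐ[stripMeasure d] diffFn α μ ξ u :=
  MemLp.coeFn_toLp (hμ.memLp_diffFn hpos h0 h2 ξ u.2)

theorem norm_sq_diffOp (u : periodicSobolev d (α / 2)) :
    ENNReal.ofReal (‖diffOp hμ hpos h0 h2 ξ u‖ ^ 2) =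
      ∫⁻ p, ENNReal.ofReal (‖diffFn α μ ξ u p‖ ^ 2) ∂(stripMeasure d) := by
  rw [← lintegral_norm_sq_Lp]
  refine lintegral_congr_ae ?_
  filter_upwards [coeFn_diffOp hμ hpos h0 h2 ξ u] with p hp
  rw [hp]

theorem integrable_formIntegrand (hμ : IsCoefficient μminus μplus μ) (hpos : 0 < μminus)
    (h0 : 0 < α) (h2 : α < 2) (ξ : Space d) (u v : periodicSobolev d (α / 2)) :
    Integrable (formIntegrand α μ ξ u v) (stripMeasure d) := by
  have h := (L2.integrable_inner (𝕜 := ℂ) (diffOp hμ hpos h0 h2 ξ v)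
    (diffOp hμ hpos h0 h2 ξ u)).const_mul 2
  refine h.congr ?_
  filter_upwards [hμ.ae_formIntegrand_eq hpos ξ (u : L2Cell d) v,
    coeFn_diffOp hμ hpos h0 h2 ξ u, coeFn_diffOp hμ hpos h0 h2 ξ v] with p h1 h2 h3
  rw [h1, h2, h3, RCLike.inner_apply]

theorem form_eq_inner (u v : periodicSobolev d (α / 2)) :
    form α μ ξ u v = ⟪diffOp hμ hpos h0 h2 ξ v, diffOp hμ hpos h0 h2 ξ u⟫_ℂ := by
  have e : ∫ p, formIntegrand α μ ξ u v p ∂(stripMeasure d) =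
      2 * ∫ p, ⟪diffOp hμ hpos h0 h2 ξ v p, diffOp hμ hpos h0 h2 ξ u p⟫_ℂ ∂(stripMeasure d) := by
    rw [← integral_const_mul]
    refine integral_congr_ae ?_
    filter_upwards [hμ.ae_formIntegrand_eq hpos ξ (u : L2Cell d) v,
      coeFn_diffOp hμ hpos h0 h2 ξ u, coeFn_diffOp hμ hpos h0 h2 ξ v] with p h1 h2 h3
    rw [h1, h2, h3, RCLike.inner_apply]
  rw [form, e, L2.inner_def]
  ring

theorem mem_operatorGraph_iff (u w : L2Cell d) : (u, w) ∈ operatorGraph α μ ξ ↔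
    ∃ h : u ∈ periodicSobolev d (α / 2), ∀ v : periodicSobolev d (α / 2),
      ⟪diffOp hμ hpos h0 h2 ξ v, diffOp hμ hpos h0 h2 ξ ⟨u, h⟩⟫_ℂ = ⟪(v : L2Cell d), w⟫_ℂ := by
  constructor
  · rintro ⟨h, hv⟩
    refine ⟨h, fun v => ?_⟩
    rw [← form_eq_inner]
    exact (hv v v.2).2
  · rintro ⟨h, hv⟩
    refine ⟨h, fun v hv' => ⟨integrable_formIntegrand hμ hpos h0 h2 ξ ⟨u, h⟩ ⟨v, hv'⟩, ?_⟩⟩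
    have := hv ⟨v, hv'⟩
    rw [← form_eq_inner] at this
    exact this

theorem mem_levyOperator_graph_iff (u w : L2Cell d) : (u, w) ∈ (levyOperator α μ ξ).graph ↔
    ∃ h : u ∈ periodicSobolev d (α / 2), ∀ v : periodicSobolev d (α / 2),
      ⟪diffOp hμ hpos h0 h2 ξ v, diffOp hμ hpos h0 h2 ξ ⟨u, h⟩⟫_ℂ = ⟪(v : L2Cell d), w⟫_ℂ := by
  rw [← mem_operatorGraph_iff, levyOperator, Submodule.toLinearPMap_graph_eq]
  -- Single-valuedness of the graph: `(0, y)` in it forces `y` to be orthogonal to the dense form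
  -- domain.
  rintro ⟨x, y⟩ hx (rfl : x = 0)
  rw [mem_operatorGraph_iff hμ hpos h0 h2] at hx
  obtain ⟨h, hv⟩ := hx
  refine (dense_periodicSobolev h0 h2).eq_zero_of_inner_left (𝕜 := ℂ) fun v hv' => ?_
  have e : (⟨0, h⟩ : periodicSobolev d (α / 2)) = 0 := rfl
  have := hv ⟨v, hv'⟩
  rw [e, map_zero, inner_zero_right] at this
  rw [← inner_conj_symm, ← this, map_zero]

/-- Along a common subsequence both sequences converge almost everywhere, which identifies the limit
with `diffFn u`. The lower bound on `μ` then gives `u` finite energy, so the limit stays in the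
domain. -/
theorem diffOp_closed (x : ℕ → periodicSobolev d (α / 2)) (u : L2Cell d)
    (g : Lp ℂ 2 (stripMeasure d)) (hx : Tendsto (fun n => (x n : L2Cell d)) atTop (𝓝 u))
    (hg : Tendsto (fun n => diffOp hμ hpos h0 h2 ξ (x n)) atTop (𝓝 g)) :
    ∃ h : u ∈ periodicSobolev d (α / 2), diffOp hμ hpos h0 h2 ξ ⟨u, h⟩ = g := by
  obtain ⟨φ, hφ, h1⟩ := exists_subseq_ae_tendsto hx
  obtain ⟨ψ, hψ, h3⟩ := exists_subseq_ae_tendsto (hg.comp hφ.tendsto_atTop)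
  have h4 := ae_strip (quasiMeasurePreserving_toCell.ae h1)
  have h5 : ∀ᵐ p ∂(stripMeasure d), ∀ n, diffOp hμ hpos h0 h2 ξ (x n) p = diffFn α μ ξ (x n) p :=
    ae_all_iff.2 fun n => coeFn_diffOp hμ hpos h0 h2 ξ (x n)
  have h6 : diffFn α μ ξ u =ᵐ[stripMeasure d] g := by
    filter_upwards [h3, h4, h5] with p h3 h4 h5
    refine tendsto_nhds_unique ?_ h3
    simp only [Function.comp_apply, h5, diffFn, bloch, periodicExt]
    exact (((h4.1.comp hψ.tendsto_atTop).const_mul _).sub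
      ((h4.2.comp hψ.tendsto_atTop).const_mul _)).const_mul _
  have h7 : energy α ξ u < ∞ := by
    have h8 := hμ.le_lintegral_diffFn (α := α) hpos ξ u
    rw [lintegral_congr_ae (g := fun p => ENNReal.ofReal (‖g p‖ ^ 2))
      (by filter_upwards [h6] with p hp; rw [hp]), lintegral_norm_sq_Lp] at h8
    by_contra h9
    rw [not_lt, top_le_iff] at h9
    rw [h9, ENNReal.mul_top (by simpa using hpos)] at h8
    exact ENNReal.ofReal_ne_top (top_le_iff.1 h8)
  have h8 := (mem_periodicSobolev_iff h0 h2 ξ u).2 h7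
  exact ⟨h8, Lp.ext ((coeFn_diffOp hμ hpos h0 h2 ξ ⟨u, h8⟩).trans h6)⟩

theorem sum_le_norm_sq_diffOp (u : periodicSobolev d (α / 2)) (s : Finset (Fin d → ℤ)) :
    ∑ n ∈ s, ‖⟪cellChar n, (u : L2Cell d)⟫_ℂ‖ ^ 2 * (μminus * c0 d α * ‖ξ + dualVec n‖ ^ α) ≤
      ‖diffOp hμ hpos h0 h2 ξ u‖ ^ 2 := by
  have hc := (c0_pos (d := d) h0 h2).le
  refine (ENNReal.ofReal_le_ofReal_iff (by positivity)).1 ?_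
  rw [norm_sq_diffOp]
  refine le_trans ?_ (hμ.le_lintegral_diffFn hpos ξ u)
  rw [energy_eq_tsum h0 h2, ENNReal.ofReal_sum_of_nonneg fun n _ => by positivity]
  refine le_trans ?_ (mul_le_mul_right (ENNReal.sum_le_tsum s) _)
  rw [Finset.mul_sum]
  refine Finset.sum_le_sum fun n _ => le_of_eq ?_
  rw [← ENNReal.ofReal_mul (by positivity), ← ENNReal.ofReal_mul (by positivity)]
  congr 1
  ring

/-- Functions without low frequencies have large energy. -/
theorem mul_norm_sq_le_norm_sq_diffOp {u : periodicSobolev d (α / 2)} {w : L2Cell d} {M : ℝ}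
    (hM : 0 ≤ M) (hw : ∀ n, ⟪cellChar n, w⟫_ℂ = 0 ∨
      (⟪cellChar n, w⟫_ℂ = ⟪cellChar n, (u : L2Cell d)⟫_ℂ ∧ M ≤ ‖ξ + dualVec n‖)) :
    μminus * c0 d α * M ^ α * ‖w‖ ^ 2 ≤ ‖diffOp hμ hpos h0 h2 ξ u‖ ^ 2 := by
  have hc := (c0_pos (d := d) h0 h2).le
  have h := (HilbertBasis.hasSum_norm_sq cellBasis w).mul_left (μminus * c0 d α * M ^ α)
  rw [coe_cellBasis] at h
  refine le_of_tendsto h (Eventually.of_forall fun s => ?_)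
  refine le_trans (Finset.sum_le_sum fun n _ => ?_) (sum_le_norm_sq_diffOp hμ hpos h0 h2 ξ u s)
  rcases hw n with h | ⟨h, hn⟩ <;> rw [h]
  · rw [norm_zero, zero_pow two_ne_zero, mul_zero]
    positivity
  · rw [mul_comm]
    gcongr

/-- The spectral gap: without the zero frequency, all remaining ones satisfy `|ξ + 2πn| ≥ 2π - |ξ| ≥
π`. -/
theorem d0_mul_norm_sq_le {ξ : Space d} (hξ : ‖ξ‖ ≤ Real.pi) (u : periodicSobolev d (α / 2))
    (hu : ⟪oneCell d, (u : L2Cell d)⟫_ℂ = 0) :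
    d0 d α μminus * ‖(u : L2Cell d)‖ ^ 2 ≤ ‖diffOp hμ hpos h0 h2 ξ u‖ ^ 2 := by
  refine mul_norm_sq_le_norm_sq_diffOp hμ hpos h0 h2 ξ Real.pi_pos.le fun n => ?_
  by_cases hn : n = 0
  · left
    rw [hn, ← oneCell_eq_cellChar, hu]
  · exact Or.inr ⟨rfl, pi_le_norm_add_dualVec hξ hn⟩

/-- Rellich's theorem by Fourier truncation: `P` keeps a finite box of frequencies, and the
remainder is controlled by the growth of the symbol. -/
theorem exists_compact_approx {ε : ℝ} (hε : 0 < ε) :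
    ∃ P : L2Cell d →L[ℂ] L2Cell d, IsCompactOperator P ∧
      ∀ v : periodicSobolev d (α / 2), ‖(v : L2Cell d) - P v‖ ≤
        ε * ‖diffOp hμ hpos h0 h2 ξ v‖ := by
  classical
  have hc := c0_pos (d := d) h0 h2
  let K := μminus * c0 d α
  have hK : 0 < K := by positivity
  -- The cut-off at which the symbol bound `K M^α` equals `ε⁻²`.
  let M := ((K * ε ^ 2)⁻¹) ^ (1 / α)
  have hM : 0 ≤ M := by positivity
  have hMα : K * M ^ α * ε ^ 2 = 1 := by
    rw [← Real.rpow_mul (by positivity), one_div_mul_cancel h0.ne', Real.rpow_one]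
    field_simp
  let N : ℤ := ⌈M + ‖ξ‖⌉
  let T : Finset (Fin d → ℤ) := Fintype.piFinset fun _ => Finset.Icc (-N) N
  have hT : ∀ n, n ∉ T → M ≤ ‖ξ + dualVec n‖ := by
    intro n hn
    rw [Fintype.mem_piFinset] at hn
    push Not at hn
    obtain ⟨i, hi⟩ := hn
    have h1 : N ≤ |n i| := by
      rw [Finset.mem_Icc, ← abs_le] at hi
      exact (not_le.1 hi).le
    have h1' : (N : ℝ) ≤ |(n i : ℝ)| := by exact_mod_cast h1
    have h2 := norm_dualVec_ge n i
    have h3 : ‖dualVec n‖ ≤ ‖ξ + dualVec n‖ + ‖ξ‖ := by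
      simpa using norm_sub_le (ξ + dualVec n) ξ
    have h4 : M + ‖ξ‖ ≤ N := Int.le_ceil _
    nlinarith [Real.pi_gt_three, abs_nonneg (n i : ℝ)]
  let W : Submodule ℂ (L2Cell d) := Submodule.span ℂ (T.image cellChar : Finset (L2Cell d))
  refine ⟨W.starProjection, ?_, fun v => ?_⟩
  · have : FiniteDimensional ℂ W := FiniteDimensional.span_finset _ _
    have : ProperSpace W := FiniteDimensional.proper ℂ W
    have h : IsCompactOperator W.orthogonalProjectionOnto :=
      isCompactOperator_of_locallyCompactSpace_dom W.orthogonalProjectionOnto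
    exact h.clm_comp W.subtypeL
  · have hcoef : ∀ n, ⟪cellChar n, (v : L2Cell d) - W.starProjection v⟫_ℂ = 0 ∨
        (⟪cellChar n, (v : L2Cell d) - W.starProjection v⟫_ℂ = ⟪cellChar n, (v : L2Cell d)⟫_ℂ ∧
          M ≤ ‖ξ + dualVec n‖) := by
      intro n
      rw [inner_sub_right, ← Submodule.inner_starProjection_left_eq_right]
      by_cases hn : n ∈ T
      · left
        rw [Submodule.starProjection_eq_self_iff.2, sub_self]
        exact Submodule.subset_span (by simpa using ⟨n, hn, rfl⟩)
      · right
        refine ⟨?_, hT n hn⟩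
        rw [(Submodule.starProjection_apply_eq_zero_iff _).2, inner_zero_left, sub_zero]
        rw [Submodule.mem_orthogonal]
        intro y hy
        induction hy using Submodule.span_induction with
        | mem y hy =>
          obtain ⟨m, hm, rfl⟩ := Finset.mem_image.1 (Finset.mem_coe.1 hy)
          refine orthonormal_cellChar.2 ?_
          rintro rfl
          exact hn hm
        | zero => simp
        | add y z _ _ hy hz => rw [inner_add_left, hy, hz, add_zero]
        | smul c y _ hy => rw [inner_smul_left, hy, mul_zero]
    have h := mul_norm_sq_le_norm_sq_diffOp hμ hpos h0 h2 ξ hM hcoef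
    refine (sq_le_sq₀ (norm_nonneg _) (by positivity)).1 ?_
    rw [mul_pow]
    calc ‖(v : L2Cell d) - W.starProjection v‖ ^ 2
        = ε ^ 2 * (K * M ^ α * ‖(v : L2Cell d) - W.starProjection v‖ ^ 2) := by
          linear_combination (-‖(v : L2Cell d) - W.starProjection v‖ ^ 2) * hMα
      _ ≤ _ := by gcongr

end diffOp

end

section

/-! ### The threshold estimate -/

section Projection

variable {H : Type*} [NormedAddCommGroup H] [InnerProductSpace ℂ H] [CompleteSpace H]

/-- An orthogonal projection whose range meets `eᗮ` trivially is close to the projection onto `e`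
if it almost fixes `e`. -/
theorem norm_sub_starProjection_le {F : H →L[ℂ] H} (hF : IsStarProjection F) {e : H}
    (he : ‖e‖ = 1) (hrank : ∀ u, F u = u → ⟪e, u⟫_ℂ = 0 → u = 0) :
    ‖F - (Submodule.span ℂ {e}).starProjection‖ ≤ 4 * ‖e - F e‖ := by
  have hFF : ∀ x, F (F x) = F x := fun x => by
    conv_rhs => rw [← hF.isIdempotentElem.eq]
    rfl
  have hsa : ∀ x y, ⟪F x, y⟫_ℂ = ⟪x, F y⟫_ℂ := fun x y =>
    (ContinuousLinearMap.isSelfAdjoint_iff_isSymmetric.1 hF.isSelfAdjoint) x y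
  have hle : ∀ x, ‖F x‖ ≤ ‖x‖ := by
    intro x
    have h1 : ⟪F x, F x⟫_ℂ = ⟪x, F x⟫_ℂ := by rw [hsa, hFF]
    have h2 := congrArg RCLike.re h1
    rw [inner_self_eq_norm_sq] at h2
    have h3 := re_inner_le_norm (𝕜 := ℂ) x (F x)
    by_contra! h
    nlinarith [norm_nonneg x, norm_nonneg (F x)]
  set w := e - F e with hw
  set P := (Submodule.span ℂ {e}).starProjection with hP
  have hPx : ∀ x, P x = ⟪e, x⟫_ℂ • e := fun x =>
    Submodule.starProjection_unit_singleton ℂ he x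
  have hinner : ∀ x, ‖⟪e, x⟫_ℂ‖ ≤ ‖x‖ := fun x => by
    simpa [he] using norm_inner_le_norm (𝕜 := ℂ) e x
  refine ContinuousLinearMap.opNorm_le_bound _ (by positivity) fun x => ?_
  have hPn : ‖P x‖ ≤ ‖x‖ := by
    rw [hPx, norm_smul, he, mul_one]
    exact hinner x
  rw [sub_apply]
  -- If `‖w‖ ≥ 1/2`, then `‖F - P‖ ≤ 2 ≤ 4‖w‖`. Otherwise `‖F e‖ > 1/2`, and it is safe to divide by
  -- `‖F e‖`.
  rcases le_or_gt (1 / 2) ‖w‖ with h | h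
  · have := norm_sub_le (F x) (P x)
    nlinarith [hle x, norm_nonneg x]
  · have hv : 1 / 2 < ‖F e‖ := by
      have : ‖e‖ ≤ ‖w‖ + ‖F e‖ := by
        simpa [hw] using norm_add_le w (F e)
      linarith
    have hev : ⟪e, F e⟫_ℂ = (‖F e‖ ^ 2 : ℝ) := by
      have h1 : ⟪e, F e⟫_ℂ = ⟪F e, F e⟫_ℂ := by rw [hsa, hFF]
      rw [h1, inner_self_eq_norm_sq_to_K]
      push_cast
      rfl
    have hne : ((‖F e‖ ^ 2 : ℝ) : ℂ) ≠ 0 := by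
      have : 0 < ‖F e‖ := by linarith
      exact_mod_cast (pow_pos this 2).ne'
    -- `F` has rank one: the difference of the two sides is fixed by `F` and orthogonal to `e`,
    -- because `(e, F e) = ‖F e‖²`.
    have hFx : ∀ y, F y = (⟪F e, y⟫_ℂ / (‖F e‖ ^ 2 : ℝ)) • F e := by
      intro y
      refine sub_eq_zero.1 (hrank _ ?_ ?_)
      · rw [map_sub, map_smul, hFF, hFF]
      · rw [inner_sub_right, inner_smul_right, hev, hsa, div_mul_cancel₀ _ hne, sub_self]
    have hperp : ⟪e, x - P x⟫_ℂ = 0 := by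
      rw [inner_sub_right, hPx, inner_smul_right, inner_self_eq_norm_sq_to_K, he]
      simp
    have hxP : ‖x - P x‖ ≤ ‖x‖ := by
      have h1 : ‖x‖ ^ 2 = ‖P x‖ ^ 2 + ‖x - P x‖ ^ 2 := by
        have h2 := norm_add_sq_eq_norm_sq_add_norm_sq_of_inner_eq_zero (𝕜 := ℂ) (P x) (x - P x)
          (by rw [hPx x, inner_smul_left, ← hPx x, hperp, mul_zero])
        rw [add_sub_cancel] at h2
        nlinarith
      nlinarith [norm_nonneg (x - P x), norm_nonneg x, sq_nonneg ‖P x‖,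
        abs_le_of_sq_le_sq' (show ‖x - P x‖ ^ 2 ≤ ‖x‖ ^ 2 by nlinarith [sq_nonneg ‖P x‖])
          (norm_nonneg x)]
    have hve : ⟪F e, x - P x⟫_ℂ = -⟪w, x - P x⟫_ℂ := by
      rw [hw, inner_sub_left, hperp, zero_sub, neg_neg]
    have h1 : ‖F (x - P x)‖ ≤ 2 * ‖w‖ * ‖x‖ := by
      rw [hFx, hve, norm_smul, norm_div, norm_neg, Complex.norm_real,
        Real.norm_of_nonneg (by positivity), div_mul_eq_mul_div, div_le_iff₀ (by positivity)]
      have h3 : ‖⟪w, x - P x⟫_ℂ‖ ≤ ‖w‖ * ‖x‖ :=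
        (norm_inner_le_norm w (x - P x)).trans (by gcongr)
      have h4 : 0 ≤ ‖w‖ * ‖x‖ := by positivity
      have h5 : 0 ≤ ‖F e‖ * (2 * ‖F e‖ - 1) := mul_nonneg (norm_nonneg _) (by linarith)
      calc ‖⟪w, x - P x⟫_ℂ‖ * ‖F e‖ ≤ (‖w‖ * ‖x‖) * ‖F e‖ := by gcongr
        _ ≤ 2 * ‖w‖ * ‖x‖ * ‖F e‖ ^ 2 := by nlinarith [mul_nonneg h4 h5]
    have h2 : ‖P x - F (P x)‖ ≤ ‖w‖ * ‖x‖ := by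
      rw [hPx, map_smul, ← smul_sub, norm_smul, mul_comm]
      gcongr
      exact hinner x
    -- The two terms contribute `2‖w‖‖x‖` and `‖w‖‖x‖`.
    have h3 : F x - P x = F (x - P x) - (P x - F (P x)) := by
      rw [map_sub]
      abel
    rw [h3]
    refine (norm_sub_le _ _).trans ?_
    nlinarith [mul_nonneg (norm_nonneg w) (norm_nonneg x)]

end Projection

/-! ### Near and far parts of the form on the constant function -/

variable {d : ℕ} {α μminus μplus : ℝ} {μ : Space d → Space d → ℝ}

instance : IsProbabilityMeasure (cellMeasure d) := by
  have := (measurePreserving_toTorus (d := d)).measure_preimage MeasurableSet.univ.nullMeasurableSet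
  rw [preimage_univ] at this
  exact ⟨this.trans IsProbabilityMeasure.measure_univ⟩

theorem lintegral_norm_periodicExt_add_le (u : L2Cell d) (z : Space d) :
    ∫⁻ x, ENNReal.ofReal ‖periodicExt u (x + z)‖ ∂(cellMeasure d) ≤ ENNReal.ofReal ‖u‖ := by
  calc ∫⁻ x, ENNReal.ofReal ‖periodicExt u (x + z)‖ ∂(cellMeasure d)
      = ∫⁻ x, ‖translate z u x‖ₑ ∂(cellMeasure d) := by
        refine lintegral_congr_ae ?_
        filter_upwards [coeFn_translate z u] with x hx
        rw [hx, ofReal_norm]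
    _ = eLpNorm (translate z u) 1 (cellMeasure d) := eLpNorm_one_eq_lintegral_enorm.symm
    _ ≤ eLpNorm (translate z u) 2 (cellMeasure d) :=
        eLpNorm_le_eLpNorm_of_exponent_le one_le_two (Lp.aestronglyMeasurable _)
    _ = ENNReal.ofReal ‖u‖ := by
        rw [← (translate z).norm_map u, Lp.norm_def, ENNReal.ofReal_toReal (Lp.eLpNorm_ne_top _)]

theorem norm_oneCell : ‖oneCell d‖ = 1 := by
  rw [oneCell_eq_cellChar]
  exact orthonormal_cellChar.1 0

theorem ae_norm_bloch_oneCell_sub_le (ξ : Space d) : ∀ᵐ p ∂(stripMeasure d),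
    ‖bloch ξ (oneCell d) p.1 - bloch ξ (oneCell d) p.2‖ ≤ min 2 (‖ξ‖ * ‖p.1 - p.2‖) := by
  have h : ∀ᵐ x ∂(volume : Measure (Space d)), periodicExt (oneCell d) x = 1 := by
    have h1 : ∀ᵐ x ∂(cellMeasure d), oneCell d x = 1 := by
      filter_upwards [indicatorConstLp_coeFn (p := 2) (hs := measurableSet_cell d)
        (hμs := cellMeasure_cell_ne_top d) (c := (1 : ℂ)), ae_mem_cell] with x hx hx'
      rw [oneCell, hx, indicator_of_mem hx']
    exact quasiMeasurePreserving_toCell.ae h1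
  filter_upwards [ae_strip h] with p hp
  have e : bloch ξ (oneCell d) p.1 - bloch ξ (oneCell d) p.2 =
      Complex.exp (Complex.I * (⟪ξ, p.2⟫_ℝ : ℝ)) *
        (Complex.exp (Complex.I * (⟪ξ, p.1 - p.2⟫_ℝ : ℝ)) - 1) := by
    rw [bloch, bloch, hp.1, hp.2, mul_sub, ← Complex.exp_add, inner_sub_right]
    push_cast
    ring_nf
  rw [e, norm_mul, norm_exp_I_inner, one_mul]
  exact le_min (norm_exp_sub_one_le_two _) (norm_exp_inner_sub_one_le _ _)

theorem IsCoefficient.le (hμ : IsCoefficient μminus μplus μ) : μminus ≤ μplus := by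
  obtain ⟨p, h1, h2⟩ := hμ.bounds.exists
  exact h1.trans h2

/-- Only the `L₁` norms of `w(x)` and `w(x + z)` enter, each at most `‖w‖` on a cell of measure one.
Using `‖w‖` rather than the energy of `w` keeps the full power of the tail integral `r`. -/
theorem IsCoefficient.far_le (hμ : IsCoefficient μminus μplus μ) (hpos : 0 < μminus)
    (hplus : 0 ≤ μplus) (ξ : Space d) (w : L2Cell d) {r : ℝ}
    (hr : ∫⁻ z in {z : Space d | 1 < ‖z‖}, ENNReal.ofReal (min 2 (‖ξ‖ * ‖z‖)) * levyKernel α z ≤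
      ENNReal.ofReal r) :
    ∫⁻ p in {p : Space d × Space d | 1 < ‖p.1 - p.2‖},
      ENNReal.ofReal (‖diffFn α μ ξ (oneCell d) p‖ * ‖diffFn α μ ξ w p‖) ∂(stripMeasure d) ≤
      ENNReal.ofReal (μplus * ‖w‖ * r) := by
  have hS : MeasurableSet {p : Space d × Space d | 1 < ‖p.1 - p.2‖} :=
    measurableSet_lt (by fun_prop) (by fun_prop)
  have hW : MeasurableSet {z : Space d | 1 < ‖z‖} :=
    measurableSet_lt (by fun_prop) (by fun_prop)
  have hmeas := measurable_periodicExt w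
  let g : Space d → ℝ≥0∞ := {z : Space d | 1 < ‖z‖}.indicator fun z =>
    ENNReal.ofReal (min 2 (‖ξ‖ * ‖z‖)) * levyKernel α z
  have hg : Measurable g := Measurable.indicator (by fun_prop) hW
  have hle : ∫⁻ p in {p : Space d × Space d | 1 < ‖p.1 - p.2‖},
      ENNReal.ofReal (‖diffFn α μ ξ (oneCell d) p‖ * ‖diffFn α μ ξ w p‖) ∂(stripMeasure d) ≤
      ∫⁻ p, (ENNReal.ofReal (μplus / 2) * (ENNReal.ofReal ‖periodicExt w (p.1 + 0)‖ +
        ENNReal.ofReal ‖periodicExt w p.2‖)) * g (p.2 - p.1) ∂(stripMeasure d) := by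
    rw [← lintegral_indicator hS]
    refine lintegral_mono_ae ?_
    filter_upwards [hμ.ae_bounds, ae_norm_bloch_oneCell_sub_le ξ] with p hp hp'
    by_cases h : 1 < ‖p.1 - p.2‖
    · have hm := hpos.le.trans hp.1
      have h3 : ‖bloch ξ w p.1 - bloch ξ w p.2‖ ≤ ‖periodicExt w p.1‖ + ‖periodicExt w p.2‖ := by
        refine (norm_sub_le _ _).trans_eq ?_
        simp only [bloch, norm_mul, norm_exp_I_inner, one_mul]
      have hgp : g (p.2 - p.1) = ENNReal.ofReal (min 2 (‖ξ‖ * ‖p.2 - p.1‖)) *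
          levyKernel α (p.2 - p.1) :=
        indicator_of_mem (s := {z : Space d | 1 < ‖z‖})
          (by rw [mem_ofPred_eq, norm_sub_rev]; exact h) _
      rw [indicator_of_mem (by exact h), hgp, add_zero, levyKernel, norm_sub_rev p.2 p.1,
        ← ENNReal.ofReal_add (by positivity) (by positivity),
        ← ENNReal.ofReal_mul (by positivity), ← ENNReal.ofReal_mul (by positivity),
        ← ENNReal.ofReal_mul (by positivity)]
      refine ENNReal.ofReal_le_ofReal ?_
      rw [diffFn, diffFn, norm_mul, norm_mul, mul_mul_mul_comm, ← norm_mul,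
        ← Complex.ofReal_mul, Real.mul_self_sqrt (by positivity), Complex.norm_real,
        Real.norm_of_nonneg (by positivity)]
      calc μ p.1 p.2 / (2 * ‖p.1 - p.2‖ ^ ((d : ℝ) + α)) *
            (‖bloch ξ (oneCell d) p.1 - bloch ξ (oneCell d) p.2‖ *
              ‖bloch ξ w p.1 - bloch ξ w p.2‖)
          ≤ μplus / (2 * ‖p.1 - p.2‖ ^ ((d : ℝ) + α)) * (min 2 (‖ξ‖ * ‖p.1 - p.2‖) *
            (‖periodicExt w p.1‖ + ‖periodicExt w p.2‖)) := by
            gcongr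
            exact hp.2
        _ = _ := by
            rw [div_mul_eq_div_div, div_eq_mul_inv (μplus / 2)]
            ring
    · rw [indicator_of_notMem (by exact h)]
      simp
  refine hle.trans ?_
  rw [lintegral_strip (by fun_prop)]
  have hz : ∀ z : Space d, ∫⁻ x, (ENNReal.ofReal (μplus / 2) *
      (ENNReal.ofReal ‖periodicExt w (x + 0)‖ + ENNReal.ofReal ‖periodicExt w (x + z)‖)) *
        g (x + z - x) ∂(cellMeasure d) ≤ ENNReal.ofReal (μplus * ‖w‖) * g z := by
    intro z
    have e : ∀ x : Space d, x + z - x = z := fun x => by abel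
    simp only [e]
    rw [lintegral_mul_const _ (by fun_prop), lintegral_const_mul _ (by fun_prop),
      lintegral_add_left (by fun_prop)]
    gcongr
    refine (mul_le_mul_right (add_le_add (lintegral_norm_periodicExt_add_le w 0)
      (lintegral_norm_periodicExt_add_le w z)) _).trans_eq ?_
    rw [← ENNReal.ofReal_add (norm_nonneg _) (norm_nonneg _), ← ENNReal.ofReal_mul (by positivity)]
    congr 1
    ring
  refine (lintegral_mono hz).trans ?_
  rw [lintegral_const_mul _ hg, lintegral_indicator hW,
    ENNReal.ofReal_mul (p := μplus * ‖w‖) (q := r) (by positivity)]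
  exact mul_le_mul' le_rfl hr

section Estimate

variable [NeZero d]

/-- The constant in the estimate of the near part of the form. -/
def nearConst (d : ℕ) (α : ℝ) : ℝ :=
  (∫⁻ z : Space d, ENNReal.ofReal (min 1 (‖z‖ ^ 2)) * levyKernel α z).toReal

/-- Here `|e^{i⟨ξ,x⟩} - e^{i⟨ξ,y⟩}| ≤ |ξ||x - y|`, and `|z|^{2-d-α}` is integrable near `0`. -/
theorem IsCoefficient.near_le (hμ : IsCoefficient μminus μplus μ) (hpos : 0 < μminus)
    (h0 : 0 < α) (h2 : α < 2) (hplus : 0 ≤ μplus) (ξ : Space d) :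
    ∫⁻ p in {p : Space d × Space d | 1 < ‖p.1 - p.2‖}ᶜ,
      ENNReal.ofReal (‖diffFn α μ ξ (oneCell d) p‖ ^ 2) ∂(stripMeasure d) ≤
      ENNReal.ofReal (μplus * nearConst d α * ‖ξ‖ ^ 2) := by
  have hS : MeasurableSet {p : Space d × Space d | 1 < ‖p.1 - p.2‖} :=
    measurableSet_lt (by fun_prop) (by fun_prop)
  have hle : ∫⁻ p in {p : Space d × Space d | 1 < ‖p.1 - p.2‖}ᶜ,
      ENNReal.ofReal (‖diffFn α μ ξ (oneCell d) p‖ ^ 2) ∂(stripMeasure d) ≤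
      ∫⁻ p, ENNReal.ofReal (μplus * ‖ξ‖ ^ 2) *
        (ENNReal.ofReal (min 1 (‖p.1 - p.2‖ ^ 2)) * levyKernel α (p.1 - p.2))
        ∂(stripMeasure d) := by
    rw [← lintegral_indicator hS.compl]
    refine lintegral_mono_ae ?_
    filter_upwards [hμ.ae_bounds, ae_norm_bloch_oneCell_sub_le ξ] with p hp hp'
    by_cases h : p ∈ {p : Space d × Space d | 1 < ‖p.1 - p.2‖}
    · rw [indicator_of_notMem (by simpa using h)]
      simp
    · rw [indicator_of_mem (by exact h), norm_sq_diffFn (hpos.le.trans hp.1)]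
      have h1 : ‖p.1 - p.2‖ ≤ 1 := by simpa using h
      rw [← mul_assoc, ← mul_assoc, ← ENNReal.ofReal_mul (by linarith),
        ← ENNReal.ofReal_mul (by positivity)]
      refine mul_le_mul' (ENNReal.ofReal_le_ofReal ?_) le_rfl
      rw [min_eq_right (by nlinarith [norm_nonneg (p.1 - p.2)])]
      have h3 := pow_le_pow_left₀ (norm_nonneg _) (hp'.trans (min_le_right _ _)) 2
      rw [mul_pow] at h3
      have h4 : 0 ≤ ‖ξ‖ ^ 2 * ‖p.1 - p.2‖ ^ 2 := by positivity
      rw [mul_assoc]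
      refine mul_le_mul ?_ h3 (by positivity) hplus
      linarith [hp.2]
  refine hle.trans ?_
  rw [lintegral_const_mul _ (by fun_prop), lintegral_strip (by fun_prop)]
  have e : ∀ x z : Space d, x - (x + z) = -z := fun x z => by abel
  simp only [e, norm_neg, levyKernel_neg, lintegral_const, measure_univ, mul_one]
  rw [mul_right_comm, ENNReal.ofReal_mul (p := μplus * ‖ξ‖ ^ 2) (q := nearConst d α)
    (by positivity), nearConst,
    ENNReal.ofReal_toReal (lintegral_min_levyKernel_lt_top h0 h2).ne]

/-- The estimate of the form on the pair `(1, w)`. -/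
theorem norm_inner_diffOp_oneCell_le (hμ : IsCoefficient μminus μplus μ) (hpos : 0 < μminus)
    (h0 : 0 < α) (h2 : α < 2) (hplus : 0 ≤ μplus) (ξ : Space d)
    (e w : periodicSobolev d (α / 2)) (he : (e : L2Cell d) = oneCell d) {r : ℝ} (hr0 : 0 ≤ r)
    (hr : ∫⁻ z in {z : Space d | 1 < ‖z‖}, ENNReal.ofReal (min 2 (‖ξ‖ * ‖z‖)) * levyKernel α z ≤
      ENNReal.ofReal r) :
    ‖⟪diffOp hμ hpos h0 h2 ξ e, diffOp hμ hpos h0 h2 ξ w⟫_ℂ‖ ≤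
      1 / 2 * (μplus * nearConst d α * ‖ξ‖ ^ 2) + 1 / 2 * ‖diffOp hμ hpos h0 h2 ξ w‖ ^ 2 +
        μplus * ‖(w : L2Cell d)‖ * r := by
  have hS : MeasurableSet {p : Space d × Space d | 1 < ‖p.1 - p.2‖} :=
    measurableSet_lt (by fun_prop) (by fun_prop)
  have hA : 0 ≤ nearConst d α := ENNReal.toReal_nonneg
  refine (ENNReal.ofReal_le_ofReal_iff (by positivity)).1 ?_
  calc ENNReal.ofReal ‖⟪diffOp hμ hpos h0 h2 ξ e, diffOp hμ hpos h0 h2 ξ w⟫_ℂ‖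
      ≤ ∫⁻ p, ‖⟪diffOp hμ hpos h0 h2 ξ e p, diffOp hμ hpos h0 h2 ξ w p⟫_ℂ‖ₑ
          ∂(stripMeasure d) := by
        rw [L2.inner_def, ofReal_norm]
        exact enorm_integral_le_lintegral_enorm _
    _ ≤ ∫⁻ p, ENNReal.ofReal (‖diffFn α μ ξ (oneCell d) p‖ * ‖diffFn α μ ξ w p‖)
          ∂(stripMeasure d) := by
        refine lintegral_mono_ae ?_
        filter_upwards [coeFn_diffOp hμ hpos h0 h2 ξ e, coeFn_diffOp hμ hpos h0 h2 ξ w]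
          with p h1 h2
        rw [h1, h2, he, ← ofReal_norm]
        exact ENNReal.ofReal_le_ofReal (norm_inner_le_norm _ _)
    _ = ∫⁻ p in {p : Space d × Space d | 1 < ‖p.1 - p.2‖}ᶜ,
          ENNReal.ofReal (‖diffFn α μ ξ (oneCell d) p‖ * ‖diffFn α μ ξ w p‖)
            ∂(stripMeasure d) +
        ∫⁻ p in {p : Space d × Space d | 1 < ‖p.1 - p.2‖},
          ENNReal.ofReal (‖diffFn α μ ξ (oneCell d) p‖ * ‖diffFn α μ ξ w p‖)
            ∂(stripMeasure d) := by
        rw [add_comm, lintegral_add_compl _ hS]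
    -- On the near part `ab ≤ (a² + b²)/2`; the factor `1/2` before `‖D w‖²` permits its later
    -- absorption.
    _ ≤ (ENNReal.ofReal (1 / 2) * ENNReal.ofReal (μplus * nearConst d α * ‖ξ‖ ^ 2) +
          ENNReal.ofReal (1 / 2) * ENNReal.ofReal (‖diffOp hμ hpos h0 h2 ξ w‖ ^ 2)) +
        ENNReal.ofReal (μplus * ‖(w : L2Cell d)‖ * r) := by
        refine add_le_add ?_ (hμ.far_le hpos hplus ξ w hr)
        have hm1 : AEMeasurable
            (fun p => ENNReal.ofReal (‖diffFn α μ ξ (oneCell d) p‖ ^ 2)) (stripMeasure d) :=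
          ((hμ.aestronglyMeasurable_diffFn (α := α) ξ (oneCell d)).norm.pow
            2).aemeasurable.ennreal_ofReal
        refine le_trans (lintegral_mono (g := fun p =>
          ENNReal.ofReal (1 / 2) * ENNReal.ofReal (‖diffFn α μ ξ (oneCell d) p‖ ^ 2) +
          ENNReal.ofReal (1 / 2) * ENNReal.ofReal (‖diffFn α μ ξ w p‖ ^ 2)) fun p => ?_) ?_
        · beta_reduce
          rw [← ENNReal.ofReal_mul (by positivity), ← ENNReal.ofReal_mul (by positivity),
            ← ENNReal.ofReal_add (by positivity) (by positivity)]
          refine ENNReal.ofReal_le_ofReal ?_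
          nlinarith [sq_nonneg (‖diffFn α μ ξ (oneCell d) p‖ - ‖diffFn α μ ξ w p‖)]
        · rw [lintegral_add_left' (hm1.const_mul _).restrict,
            lintegral_const_mul' _ _ ENNReal.ofReal_ne_top,
            lintegral_const_mul' _ _ ENNReal.ofReal_ne_top]
          gcongr
          · exact hμ.near_le hpos h0 h2 hplus ξ
          · rw [norm_sq_diffOp]
            exact setLIntegral_le_lintegral _ _
    _ = _ := by
        rw [← ENNReal.ofReal_mul (by positivity), ← ENNReal.ofReal_mul (by positivity),
          ← ENNReal.ofReal_add (by positivity) (by positivity),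
          ← ENNReal.ofReal_add (by positivity) (by positivity)]

/-- The threshold estimate for the spectral projection, in terms of the rate. -/
theorem exists_threshold_estimate (d : ℕ) [NeZero d] {μminus α : ℝ} (μplus : ℝ)
    (hpos : 0 < μminus) (h0 : 0 < α) (h2 : α < 2) :
    ∃ C : ℝ, 0 ≤ C ∧ ∀ μ : Space d → Space d → ℝ, IsCoefficient μminus μplus μ →
      ∀ ξ : Space d, ‖ξ‖ ≤ Real.pi → ∃ F : L2Cell d →L[ℂ] L2Cell d,
        IsSpectralProjection (levyOperator α μ ξ) (Icc 0 (d0 d α μminus / 3)) F ∧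
        ‖F - projConst d‖ ≤ C * (‖ξ‖ + thresholdRate α ‖ξ‖) := by
  obtain ⟨G, hG0, hG⟩ := exists_lintegral_far_le (d := d) h0
  have hd0 : 0 < d0 d α μminus := by
    have := c0_pos (d := d) h0 h2
    unfold d0
    positivity
  obtain ⟨c, hc⟩ : ∃ c, c = d0 d α μminus / 3 := ⟨_, rfl⟩
  have hcpos : 0 < c := by rw [hc]; positivity
  rw [← hc]
  have hA : 0 ≤ nearConst d α := ENNReal.toReal_nonneg
  -- The constant produced by `h3` and `h4` below; it does not involve `μ` or `ξ`.
  let K : ℝ := (2 / c) * (μplus * nearConst d α + 2 * (μplus * G) ^ 2 / c)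
  refine ⟨4 * √K, by positivity, fun μ hμ ξ hξ => ?_⟩
  have hplus : 0 ≤ μplus := hpos.le.trans hμ.le
  have hK : 0 ≤ K := by positivity
  obtain ⟨ι, b, lam, hlam, hchar⟩ := exists_eigenbasis (diffOp hμ hpos h0 h2 ξ)
    (dense_periodicSobolev h0 h2) (diffOp_closed hμ hpos h0 h2 ξ)
    (fun ε hε => exists_compact_approx hμ hpos h0 h2 ξ hε)
  have hspec : IsSpectralMeasure (levyOperator α μ ξ) (diagProj b lam) :=
    isSpectralMeasure_diagProj b lam _ fun u w =>
      (mem_levyOperator_graph_iff hμ hpos h0 h2 ξ u w).trans (hchar u w)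
  refine ⟨diagProj b lam (Icc 0 c), ⟨_, hspec, rfl⟩, ?_⟩
  -- On the range the form is at most `c‖u‖²`, on `1^⊥` at least `3c‖u‖²`.
  have hrank : ∀ u, diagProj b lam (Icc 0 c) u = u → ⟪oneCell d, u⟫_ℂ = 0 → u = 0 := by
    intro u hu hu1
    obtain ⟨h, hle⟩ := norm_sq_form_diagProj_le hlam hchar hu
    have hge := d0_mul_norm_sq_le hμ hpos h0 h2 hξ ⟨u, h⟩ hu1
    have h3 : d0 d α μminus = 3 * c := by rw [hc]; ring
    rw [h3] at hge
    have h4 : ‖u‖ ^ 2 ≤ 0 := by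
      have : c * ‖u‖ ^ 2 ≤ 0 := by
        simp only at hge
        linarith
      by_contra! h5
      nlinarith
    exact norm_eq_zero.1 (pow_eq_zero_iff two_ne_zero |>.1 (le_antisymm h4 (sq_nonneg _)))
  have hproj := norm_sub_starProjection_le
    (hspec.isStarProjection (Icc 0 c) measurableSet_Icc) (norm_oneCell (d := d)) hrank
  refine hproj.trans ?_
  rw [mul_assoc]
  refine mul_le_mul_of_nonneg_left ?_ (by norm_num)
  have hone : oneCell d ∈ periodicSobolev d (α / 2) := by
    rw [oneCell_eq_cellChar]
    exact cellChar_mem_periodicSobolev h0 h2 0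
  obtain ⟨hw, hinner, hlow⟩ := form_diagProj_compl hlam hchar hcpos.le ⟨oneCell d, hone⟩
  have hr0 : 0 ≤ thresholdRate α ‖ξ‖ := thresholdRate_nonneg (norm_nonneg ξ)
  have hmain := norm_inner_diffOp_oneCell_le hμ hpos h0 h2 hplus ξ ⟨oneCell d, hone⟩ ⟨_, hw⟩ rfl
    (r := G * thresholdRate α ‖ξ‖) (by positivity) (hG _ (norm_nonneg ξ))
  rw [hinner, Complex.norm_real, Real.norm_of_nonneg (sq_nonneg _)] at hmain
  simp only at hmain hlow ⊢
  generalize ‖diffOp hμ hpos h0 h2 ξ ⟨_, hw⟩‖ = X at hmain hlow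
  generalize ‖oneCell d - diagProj b lam (Icc 0 c) (oneCell d)‖ = y at hmain hlow ⊢
  generalize thresholdRate α ‖ξ‖ = r at hmain hr0 ⊢
  have hs := norm_nonneg ξ
  generalize ‖ξ‖ = s at hmain hs ⊢
  -- By `hinner` the left side of `hmain` is `X²`: its half on the right is absorbed, and `c y² ≤
  -- X²`.
  have h3 : c * y ^ 2 ≤ μplus * nearConst d α * s ^ 2 + 2 * (μplus * y * (G * r)) := by
    linarith
  -- Young's inequality, weighted so that half of `c y²` survives.
  have h4 : 2 * (μplus * y * (G * r)) ≤ c / 2 * y ^ 2 + 2 * (μplus * G) ^ 2 / c * r ^ 2 := by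
    have h5 : 0 ≤ c / 2 * (y - 2 * (μplus * G) * r / c) ^ 2 := by positivity
    have h6 : c / 2 * (y - 2 * (μplus * G) * r / c) ^ 2 =
        c / 2 * y ^ 2 + 2 * (μplus * G) ^ 2 / c * r ^ 2 - 2 * (μplus * y * (G * r)) := by
      field_simp
      ring
    linarith
  have h5 : y ^ 2 ≤ K * (s + r) ^ 2 := by
    have h6 : c / 2 * y ^ 2 ≤ (μplus * nearConst d α + 2 * (μplus * G) ^ 2 / c) * (s + r) ^ 2 := by
      have h7 : 0 ≤ μplus * nearConst d α := by positivity
      have h8 : 0 ≤ 2 * (μplus * G) ^ 2 / c := by positivity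
      have h9 : s ^ 2 ≤ (s + r) ^ 2 := by nlinarith
      have h10 : r ^ 2 ≤ (s + r) ^ 2 := by nlinarith
      nlinarith [mul_le_mul_of_nonneg_left h9 h7, mul_le_mul_of_nonneg_left h10 h8]
    calc y ^ 2 = 2 / c * (c / 2 * y ^ 2) := by field_simp
      _ ≤ 2 / c * ((μplus * nearConst d α + 2 * (μplus * G) ^ 2 / c) * (s + r) ^ 2) := by gcongr
      _ = _ := by ring
  refine (Real.le_sqrt_of_sq_le h5).trans_eq ?_
  rw [Real.sqrt_mul hK, Real.sqrt_sq (by positivity)]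

theorem delta0_le_pi {μminus μplus α : ℝ} (hpos : 0 < μminus) (hle : μminus ≤ μplus)
    (h0 : 0 < α) : delta0 α μminus μplus ≤ Real.pi := by
  unfold delta0
  refine mul_le_of_le_one_right Real.pi_pos.le ?_
  have hp : 0 < μplus := hpos.trans_le hle
  refine Real.rpow_le_one (by positivity) ?_ (by positivity)
  rw [div_le_one (by positivity)]
  linarith

end Estimate

end

end LevyBloch

end

/-! ### Absorbing the linear term into the rate -/

theorem mainTheorem6 (d : ℕ) [NeZero d] (μminus μplus : ℝ) (hμ : 0 < μminus) :
    (∀ α : ℝ, 0 < α → α < 1 → ∃ C : ℝ, ∀ μ : LevyBloch.Space d → LevyBloch.Space d → ℝ,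
      LevyBloch.IsCoefficient μminus μplus μ →
      ∀ ξ : LevyBloch.Space d, ‖ξ‖ ≤ LevyBloch.delta0 α μminus μplus →
        ∃ F : LevyBloch.L2Cell d →L[ℂ] LevyBloch.L2Cell d,
          LevyBloch.IsSpectralProjection (LevyBloch.levyOperator α μ ξ)
            (Set.Icc 0 (LevyBloch.d0 d α μminus / 3)) F ∧
          ‖F - LevyBloch.projConst d‖ ≤ C * ‖ξ‖ ^ α) ∧
    (∀ α : ℝ, 1 ≤ α → α < 2 → ∃ C : ℝ, ∀ μ : LevyBloch.Space d → LevyBloch.Space d → ℝ,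
      LevyBloch.IsCoefficient μminus μplus μ →
      ∀ ξ : LevyBloch.Space d, ‖ξ‖ ≤ LevyBloch.delta0 α μminus μplus →
        ∃ F : LevyBloch.L2Cell d →L[ℂ] LevyBloch.L2Cell d,
          LevyBloch.IsSpectralProjection (LevyBloch.levyOperator α μ ξ)
            (Set.Icc 0 (LevyBloch.d0 d α μminus / 3)) F ∧
          ‖F - LevyBloch.projConst d‖ ≤ C * LevyBloch.Theta α ξ) := by
  refine ⟨fun α h0 h1 => ?_, fun α h1 h2 => ?_⟩
  · obtain ⟨C, hC0, hC⟩ := LevyBloch.exists_threshold_estimate d μplus hμ h0 (by linarith)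
    -- For `|ξ| ≤ π` the near contribution satisfies `|ξ| ≤ π^{1-α}|ξ|^α`.
    refine ⟨C * (Real.pi ^ (1 - α) + 1), fun μ hcoef ξ hξ => ?_⟩
    have hξ' := hξ.trans (LevyBloch.delta0_le_pi hμ hcoef.le h0)
    obtain ⟨F, hF, hle⟩ := hC μ hcoef ξ hξ'
    refine ⟨F, hF, hle.trans ?_⟩
    rw [mul_assoc]
    refine mul_le_mul_of_nonneg_left ?_ hC0
    have h3 : LevyBloch.thresholdRate α ‖ξ‖ = ‖ξ‖ ^ α := by
      simp [LevyBloch.thresholdRate, h1]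
    rw [h3, add_mul, one_mul]
    gcongr
    calc ‖ξ‖ = ‖ξ‖ ^ (1 - α) * ‖ξ‖ ^ α := by
          rw [← Real.rpow_add' (norm_nonneg ξ) (by norm_num), sub_add_cancel, Real.rpow_one]
      _ ≤ Real.pi ^ (1 - α) * ‖ξ‖ ^ α := by
          have : 0 ≤ 1 - α := by linarith
          gcongr
  · have h0 : 0 < α := by linarith
    obtain ⟨C, hC0, hC⟩ := LevyBloch.exists_threshold_estimate d μplus hμ h0 h2
    -- The rate is `Θ(ξ)`, and `|ξ| ≤ Θ(ξ)`.
    refine ⟨C * 2, fun μ hcoef ξ hξ => ?_⟩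
    have hξ' := hξ.trans (LevyBloch.delta0_le_pi hμ hcoef.le h0)
    obtain ⟨F, hF, hle⟩ := hC μ hcoef ξ hξ'
    refine ⟨F, hF, hle.trans ?_⟩
    rw [mul_assoc]
    refine mul_le_mul_of_nonneg_left ?_ hC0
    have h3 : LevyBloch.thresholdRate α ‖ξ‖ = LevyBloch.Theta α ξ := by
      simp [LevyBloch.thresholdRate, LevyBloch.Theta, h1.not_gt]
    have h4 : ‖ξ‖ ≤ LevyBloch.Theta α ξ := by
      unfold LevyBloch.Theta
      split_ifs
      · exact le_mul_of_one_le_right (norm_nonneg ξ) (by simp)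
      · exact le_rfl
    rw [h3]
    linarith
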